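/- Let $N\ge 1$ be an integer and $q=e^{2\pi i z}$. Let $\mathbb{C}(X_0(N))$ be the field of meromorphic functions on the compact Riemann surface $X_0(N)$, i.e. of the $\Gamma_0(N)$-invariant meromorphic functions on the upper half-plane that are meromorphic at all cusps. Consider the model of $X_0(N)$ over $\mathbb{Q}$ whose function field $\mathbb{Q}(X_0(N))$ consists of the functions in $\mathbb{C}(X_0(N))$ with rational $q$-expansion at the cusp $\infty$. For a subfield $K\subseteq\mathbb{C}$ let $K(X_0(N))=K\otimes\mathbb{Q}(X_0(N))$ be the compositum of $K$ and $\mathbb{Q}(X_0(N))$ in $\mathbb{C}(X_0(N))$. An automorphism $\sigma$ of $X_0(N)$ over $\mathbb{C}$ is defined over $K$ if $\sigma^*$ restricts to a $K$-automorphism of $K(X_0(N))$; the field of definition of $\sigma$ is the smallest subfield of $\mathbb{C}$ over which $\sigma$ is defined. For a positive divisor $d$ of $N$ with $\gcd(d,N/d)=1$, let $w_d$ be the Atkin–Lehner involution of $X_0(N)$ induced by any matrix $\frac{1}{\sqrt d}\begin{pmatrix} Ad & B\\ NC & Dd\end{pmatrix}$ of determinant $1$ with $A,B,C,D\in\mathbb{Z}$.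 Let $2^{e_2}$ and $3^{e_3}$ be the exact powers of $2$ and $3$ dividing $N$, put $\nu_2=2^{\min(3,\lfloor e_2/2\rfloor)}$ and $\nu_3=3^{\min(1,\lfloor e_3/2\rfloor)}$, and for a positive integer $d$ dividing $\nu_2$ or $\nu_3$ let $S_d$ be the automorphism of $X_0(N)$ induced by $\begin{pmatrix}1&1/d\\0&1\end{pmatrix}$, which normalizes $\Gamma_0(N)$. Then every $w_d$ has field of definition $\mathbb{Q}$; if $2\mid \nu_2$, then $S_2$ has field of definition $\mathbb{Q}$; and for every $d>2$ dividing $\nu_2$ or $\nu_3$ the field of definition of $S_d$ is $\mathbb{Q}(\zeta_d)$, where $\zeta_d$ is a primitive $d$-th root of unity. -/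

import Mathlib

open scoped MatrixGroups Topology
open Filter UpperHalfPlane

noncomputable section

namespace ModularCurve

/-! ### Meromorphic functions on the upper half-plane

A meromorphic function is represented by functions `ℍ → ℂ`, two of them being identified when they
agree outside a closed discrete set (so values at poles and at removable singularities are
irrelevant). -/

/-- Functions `ℍ → ℂ` modulo equality off a closed discrete subset of `ℍ`. -/
abbrev FunGerm : Type := Germ (codiscrete ℍ) ℂ

instance : Algebra ℂ FunGerm :=
  Algebra.ofModule
    (by
      intro r x y
      induction x using Germ.inductionOn with | _ f
      induction y using Germ.inductionOn with | _ g
      exact congrArg _ (smul_mul_assoc r f g))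
    (by
      intro r x y
      induction x using Germ.inductionOn with | _ f
      induction y using Germ.inductionOn with | _ g
      exact congrArg _ (mul_smul_comm r f g))

lemma algebraMap_eq (c : ℂ) : algebraMap ℂ FunGerm c = ((fun _ => c : ℍ → ℂ) : FunGerm) := by
  rw [Algebra.algebraMap_eq_smul_one]
  exact congrArg _ (funext fun z => mul_one c)

/-- The class of functions having a representative that is meromorphic at every point of `ℍ`. -/
def IsMero (φ : FunGerm) : Prop :=
  ∃ f : ℍ → ℂ, (f : FunGerm) = φ ∧ ∀ z : ℍ, MeromorphicAt (f ∘ ofComplex) (z : ℂ)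

/-- The meromorphic functions on `ℍ`, as a `ℂ`-algebra. -/
def Mero : Subalgebra ℂ FunGerm where
  carrier := {φ | IsMero φ}
  mul_mem' := by
    rintro _ _ ⟨f, rfl, hf⟩ ⟨g, rfl, hg⟩
    exact ⟨f * g, rfl, fun z => (hf z).mul (hg z)⟩
  add_mem' := by
    rintro _ _ ⟨f, rfl, hf⟩ ⟨g, rfl, hg⟩
    exact ⟨f + g, rfl, fun z => (hf z).add (hg z)⟩
  algebraMap_mem' := fun c => ⟨fun _ => c, (algebraMap_eq c).symm, fun _ => MeromorphicAt.const c _⟩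

lemma eventually_codiscrete {p : ℂ → Prop} (h : ∀ z : ℍ, ∀ᶠ w in 𝓝[≠] (z : ℂ), p w) :
    ∀ᶠ z : ℍ in codiscrete ℍ, p z := by
  rw [Filter.Eventually, mem_codiscrete]
  intro z
  rw [disjoint_principal_right, compl_compl]
  have ht : Tendsto ((↑) : ℍ → ℂ) (𝓝[≠] z) (𝓝[≠] (z : ℂ)) :=
    tendsto_nhdsWithin_of_tendsto_nhds_of_eventually_within _
      ((UpperHalfPlane.continuous_coe.tendsto z).mono_left nhdsWithin_le_nhds)
      (by
        filter_upwards [self_mem_nhdsWithin] with w hw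
        exact fun h => hw (UpperHalfPlane.ext h))
  exact ht (h z)

lemma Mero.inv_mem {φ : FunGerm} (h : IsMero φ) : IsMero φ⁻¹ := by
  obtain ⟨f, rfl, hf⟩ := h
  exact ⟨f⁻¹, rfl, fun z => (hf z).inv⟩

lemma Mero.mul_inv {φ : FunGerm} (h : IsMero φ) (h0 : φ ≠ 0) : φ * φ⁻¹ = 1 := by
  obtain ⟨f, rfl, hf⟩ := h
  have hU : MeromorphicOn (f ∘ ofComplex) upperHalfPlaneSet := fun x hx => hf ⟨x, hx⟩
  have hconn : IsPreconnected upperHalfPlaneSet := (convex_halfSpace_im_gt 0).isPreconnected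
  have hne : ∀ z : ℍ, meromorphicOrderAt (f ∘ ofComplex) (z : ℂ) ≠ ⊤ := by
    intro z hz
    apply h0
    refine Germ.coe_eq.2 ?_
    have : ∀ w : ℍ, ∀ᶠ x in 𝓝[≠] (w : ℂ), (f ∘ ofComplex) x = 0 := by
      intro w
      rw [← meromorphicOrderAt_eq_top_iff]
      by_contra hw
      exact hU.meromorphicOrderAt_ne_top_of_isPreconnected hconn w.2 z.2 hw hz
    filter_upwards [eventually_codiscrete this] with w hw
    simpa using hw
  refine Germ.coe_eq.2 ?_
  have : ∀ w : ℍ, ∀ᶠ x in 𝓝[≠] (w : ℂ), (f ∘ ofComplex) x ≠ 0 := fun w =>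
    (meromorphicOrderAt_ne_top_iff_eventually_ne_zero (hf w)).1 (hne w)
  filter_upwards [eventually_codiscrete this] with w hw
  have : f w ≠ 0 := by simpa using hw
  simp [this]

instance : NeBot (codiscrete ℍ) := by
  refine ⟨fun h => ?_⟩
  have h0 : (∅ : Set ℍ) ∈ codiscrete ℍ := by rw [h]; exact mem_bot
  rw [mem_codiscrete'] at h0
  have h1 : IsDiscrete (Set.univ : Set ℍ) := by simpa using h0.2
  have h2 : IsOpen ({I} : Set ℍ) := by
    have : DiscreteTopology ℍ := by
      rw [isDiscrete_univ_iff] at h1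
      exact h1
    exact isOpen_discrete _
  have h3 := isOpenEmbedding_coe.isOpenMap _ h2
  rw [Set.image_singleton] at h3
  exact not_isOpen_singleton _ h3

/-- The field of meromorphic functions on `ℍ`. -/
instance : Field Mero where
  inv φ := ⟨(φ : FunGerm)⁻¹, Mero.inv_mem φ.2⟩
  exists_pair_ne := ⟨0, 1, fun h => zero_ne_one (congrArg Subtype.val h)⟩
  mul_inv_cancel φ h := Subtype.ext (Mero.mul_inv φ.2 fun h0 => h (Subtype.ext h0))
  inv_zero := Subtype.ext (congrArg _ (funext fun z => inv_zero) : (0 : FunGerm)⁻¹ = 0)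
  nnqsmul := _
  qsmul := _

lemma Mero.coe_inv (φ : Mero) : ((φ⁻¹ : Mero) : FunGerm) = (φ : FunGerm)⁻¹ := rfl

lemma tendsto_smul_codiscrete (g : SL(2, ℝ)) :
    Tendsto (fun z : ℍ => g • z) (codiscrete ℍ) (codiscrete ℍ) := by
  intro S hS
  rw [mem_codiscrete] at hS
  rw [mem_map, mem_codiscrete]
  intro z
  have h := hS (g • z)
  rw [disjoint_principal_right, compl_compl] at h ⊢
  have ht : Tendsto (fun z : ℍ => g • z) (𝓝[≠] z) (𝓝[≠] (g • z)) :=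
    tendsto_nhdsWithin_of_tendsto_nhds_of_eventually_within _
      (((continuous_const_smul g).tendsto z).mono_left nhdsWithin_le_nhds)
      (by
        filter_upwards [self_mem_nhdsWithin] with w hw
        exact fun h => hw (MulAction.injective g h))
  exact ht h

/-- The pull-back `f ↦ f ∘ g` of meromorphic functions along the Möbius transformation of `ℍ`
given by `g ∈ SL₂(ℝ)`. -/
def pullback (g : SL(2, ℝ)) : Mero →ₐ[ℂ] Mero where
  toFun φ := ⟨(φ : FunGerm).compTendsto (fun z : ℍ => g • z) (tendsto_smul_codiscrete g), by
    obtain ⟨_, f, rfl, hf⟩ := φ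
    refine ⟨fun z => f (g • z), rfl, fun z => ?_⟩
    have hg : AnalyticAt ℂ (fun w : ℂ => ((g • ofComplex w : ℍ) : ℂ)) (z : ℂ) :=
      UpperHalfPlane.analyticAt_smul (g := Matrix.SpecialLinearGroup.mapGL ℝ g) (by simp) z
    have hfg : MeromorphicAt (f ∘ ofComplex) ((g • ofComplex (z : ℂ) : ℍ) : ℂ) := hf _
    refine (MeromorphicAt.comp_analyticAt (f := f ∘ ofComplex)
      (g := fun w : ℂ => ((g • ofComplex w : ℍ) : ℂ)) hfg hg).congr
      (Eventually.of_forall fun w => ?_)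
    simp⟩
  map_one' := rfl
  map_zero' := rfl
  map_mul' := by
    rintro ⟨_, f, rfl, hf⟩ ⟨_, f', rfl, hf'⟩
    rfl
  map_add' := by
    rintro ⟨_, f, rfl, hf⟩ ⟨_, f', rfl, hf'⟩
    rfl
  commutes' c := by
    apply Subtype.ext
    show (algebraMap ℂ FunGerm c).compTendsto (fun z : ℍ => g • z) (tendsto_smul_codiscrete g) =
      algebraMap ℂ FunGerm c
    rw [algebraMap_eq]
    rfl

lemma pullback_one (φ : Mero) : pullback 1 φ = φ := by
  obtain ⟨_, f, rfl, hf⟩ := φ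
  refine Subtype.ext (congrArg Germ.ofFun (funext fun z => ?_))
  show f ((1 : SL(2, ℝ)) • z) = f z
  rw [one_smul]

lemma pullback_pullback (g h : SL(2, ℝ)) (φ : Mero) :
    pullback h (pullback g φ) = pullback (g * h) φ := by
  obtain ⟨_, f, rfl, hf⟩ := φ
  refine Subtype.ext (congrArg Germ.ofFun (funext fun z => ?_))
  show f (g • h • z) = f ((g * h) • z)
  rw [mul_smul]

/-! ### The function field of `X₀(N)` over `ℂ` -/

/-- `Γ₀(N)` as a subgroup of `SL₂(ℝ)`. -/
def Gamma0R (N : ℕ) : Subgroup SL(2, ℝ) :=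
  (CongruenceSubgroup.Gamma0 N).map (Matrix.SpecialLinearGroup.map (Int.castRingHom ℝ))

/-- The translation matrix `(1 x; 0 1)`. -/
def transl (x : ℝ) : SL(2, ℝ) := ⟨!![1, x; 0, 1], by simp [Matrix.det_fin_two]⟩

/-- `φ` is a meromorphic function of `q_h = exp(2πiz/h)` in a neighbourhood of `q_h = 0`. -/
def IsMeroAtInfty (h : ℝ) (φ : Mero) : Prop :=
  ∃ f : ℍ → ℂ, (f : FunGerm) = φ ∧ ∃ G : ℂ → ℂ, MeromorphicAt G 0 ∧
    ∀ᶠ z : ℍ in atImInfty, f z = G (Function.Periodic.qParam h z)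

/-- The field `ℂ(X₀(N))` of meromorphic functions on the compact Riemann surface `X₀(N)`:
the `Γ₀(N)`-invariant meromorphic functions on `ℍ` that are meromorphic at all cusps.
The cusps of `Γ₀(N)` are the points `g ∞` with `g ∈ SL₂(ℝ)` for which some translation
`z ↦ z + h`, `h > 0`, lies in `g⁻¹ Γ₀(N) g`. For the least such `h` (the width), `exp(2πiz/h)`
with `z` replaced by `g⁻¹ z` is a local parameter at the cusp; the other `h` are its multiples,
and for them the condition is equivalent. -/
def complexFunctionField (N : ℕ) : IntermediateField ℂ Mero where
  carrier := {φ | (∀ γ ∈ Gamma0R N, pullback γ φ = φ) ∧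
    ∀ (g : SL(2, ℝ)) (h : ℝ), 0 < h → g * transl h * g⁻¹ ∈ Gamma0R N →
      IsMeroAtInfty h (pullback g φ)}
  mul_mem' := by
    rintro a b ⟨ha, ha'⟩ ⟨hb, hb'⟩
    refine ⟨fun γ hγ => by rw [map_mul, ha γ hγ, hb γ hγ], fun g h hh hg => ?_⟩
    obtain ⟨f, hf, G, hG, hfG⟩ := ha' g h hh hg
    obtain ⟨f', hf', G', hG', hfG'⟩ := hb' g h hh hg
    refine ⟨f * f', ?_, G * G', hG.mul hG', ?_⟩
    · rw [map_mul, Germ.coe_mul, hf, hf']; rfl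
    · filter_upwards [hfG, hfG'] with z h1 h2
      simp [h1, h2]
  add_mem' := by
    rintro a b ⟨ha, ha'⟩ ⟨hb, hb'⟩
    refine ⟨fun γ hγ => by rw [map_add, ha γ hγ, hb γ hγ], fun g h hh hg => ?_⟩
    obtain ⟨f, hf, G, hG, hfG⟩ := ha' g h hh hg
    obtain ⟨f', hf', G', hG', hfG'⟩ := hb' g h hh hg
    refine ⟨f + f', ?_, G + G', hG.add hG', ?_⟩
    · rw [map_add, Germ.coe_add, hf, hf']; rfl
    · filter_upwards [hfG, hfG'] with z h1 h2
      simp [h1, h2]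
  algebraMap_mem' c := by
    refine ⟨fun γ _ => AlgHom.commutes _ _, fun g h hh hg => ?_⟩
    refine ⟨fun _ => c, ?_, fun _ => c, MeromorphicAt.const c _, Eventually.of_forall fun _ => rfl⟩
    rw [AlgHom.commutes]
    exact (algebraMap_eq c).symm
  inv_mem' := by
    rintro a ⟨ha, ha'⟩
    refine ⟨fun γ hγ => by rw [map_inv₀, ha γ hγ], fun g h hh hg => ?_⟩
    obtain ⟨f, hf, G, hG, hfG⟩ := ha' g h hh hg
    refine ⟨f⁻¹, ?_, G⁻¹, hG.inv, ?_⟩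
    · rw [map_inv₀, Germ.coe_inv, hf]; rfl
    · filter_upwards [hfG] with z h1
      simp [h1]

lemma pullback_mem {N : ℕ} {g : SL(2, ℝ)}
    (hg : g ∈ Subgroup.normalizer (Gamma0R N : Set SL(2, ℝ))) {φ : Mero}
    (hφ : φ ∈ complexFunctionField N) : pullback g φ ∈ complexFunctionField N := by
  obtain ⟨h1, h2⟩ := hφ
  rw [Subgroup.mem_normalizer_iff] at hg
  refine ⟨fun γ hγ => ?_, fun k h hh hk => ?_⟩
  · have : g * γ = (g * γ * g⁻¹) * g := by group
    rw [pullback_pullback, this, ← pullback_pullback, h1 _ ((hg γ).1 hγ)]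
  · rw [pullback_pullback]
    refine h2 (g * k) h hh ?_
    have : g * k * transl h * (g * k)⁻¹ = g * (k * transl h * k⁻¹) * g⁻¹ := by group
    rw [this]
    exact (hg _).1 hk

/-- The automorphism of `X₀(N)` over `ℂ` induced by an element `g` of the normalizer of `Γ₀(N)` in
`SL₂(ℝ)`, given by its action `f ↦ f ∘ g` on the function field. -/
def normalizerAut {N : ℕ} (g : Subgroup.normalizer (Gamma0R N : Set SL(2, ℝ))) :
    complexFunctionField N ≃ₐ[ℂ] complexFunctionField N where
  toFun φ := ⟨pullback g φ, pullback_mem g.2 φ.2⟩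
  invFun φ := ⟨pullback (g : SL(2, ℝ))⁻¹ φ, pullback_mem (inv_mem g.2) φ.2⟩
  left_inv φ := Subtype.ext (by
    show pullback (g : SL(2, ℝ))⁻¹ (pullback g φ) = φ
    rw [pullback_pullback, mul_inv_cancel, pullback_one])
  right_inv φ := Subtype.ext (by
    show pullback g (pullback (g : SL(2, ℝ))⁻¹ φ) = φ
    rw [pullback_pullback, inv_mul_cancel, pullback_one])
  map_mul' _ _ := Subtype.ext (map_mul _ _ _)
  map_add' _ _ := Subtype.ext (map_add _ _ _)
  commutes' _ := Subtype.ext (AlgHom.commutes _ _)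

/-! ### The model of `X₀(N)` over `ℚ` and fields of definition -/

/-- The Fourier expansion of `φ` at the cusp `∞` in `q = exp(2πiz)` is a Laurent series with
rational coefficients. -/
def HasRationalQExpansion (φ : Mero) : Prop :=
  ∃ f : ℍ → ℂ, (f : FunGerm) = φ ∧ ∃ P : LaurentSeries ℚ, ∀ᶠ z : ℍ in atImInfty,
    HasSum (fun n : ℤ => ((P.coeff n : ℚ) : ℂ) * Function.Periodic.qParam 1 z ^ n) (f z)

/-- The functions in `ℂ(X₀(N))` with rational `q`-expansion at `∞`; they form the function field
`ℚ(X₀(N))` of the model of `X₀(N)` over `ℚ`. -/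
def rationalFunctions (N : ℕ) : Set (complexFunctionField N) :=
  {φ | HasRationalQExpansion φ}

/-- For a subfield `K` of `ℂ`, the function field `K(X₀(N)) = K ⊗ ℚ(X₀(N))` of the base change to
`K` of the model of `X₀(N)` over `ℚ`: the compositum of `K` and `ℚ(X₀(N))` in `ℂ(X₀(N))`. -/
def functionFieldOver (N : ℕ) (K : IntermediateField ℚ ℂ) :
    IntermediateField K (complexFunctionField N) :=
  IntermediateField.adjoin K (rationalFunctions N)

/-- An automorphism of `X₀(N)` over `ℂ` is defined over `K ⊆ ℂ` if it is the base change of an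
automorphism over `K` of the `K`-curve `X₀(N)`. -/
def IsDefinedOver {N : ℕ} (σ : complexFunctionField N ≃ₐ[ℂ] complexFunctionField N)
    (K : IntermediateField ℚ ℂ) : Prop :=
  ∃ τ : functionFieldOver N K ≃ₐ[K] functionFieldOver N K,
    ∀ φ : functionFieldOver N K,
      ((τ φ : functionFieldOver N K) : complexFunctionField N) = σ (φ : complexFunctionField N)

/-- `K` is the field of definition of `σ`: the smallest subfield of `ℂ` over which `σ` is
defined. -/
def IsFieldOfDefinition {N : ℕ} (σ : complexFunctionField N ≃ₐ[ℂ] complexFunctionField N)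
    (K : IntermediateField ℚ ℂ) : Prop :=
  IsLeast {L : IntermediateField ℚ ℂ | IsDefinedOver σ L} K

/-! ### The automorphisms `w_d` and `S_d` -/

lemma mul_entry (g h : SL(2, ℝ)) (i j : Fin 2) :
    (g * h) i j = g i 0 * h 0 j + g i 1 * h 1 j := by
  rw [Matrix.SpecialLinearGroup.coe_mul, Matrix.mul_apply, Fin.sum_univ_two]

lemma mem_Gamma0R_iff {N : ℕ} {g : SL(2, ℝ)} : g ∈ Gamma0R N ↔
    ∃ a b c e : ℤ, g 0 0 = a ∧ g 0 1 = b ∧ g 1 0 = N * c ∧ g 1 1 = e := by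
  constructor
  · rintro ⟨γ, hγ, rfl⟩
    obtain ⟨c, hc⟩ := (ZMod.intCast_zmod_eq_zero_iff_dvd _ N).1
      (CongruenceSubgroup.Gamma0_mem.1 hγ)
    exact ⟨γ 0 0, γ 0 1, c, γ 1 1, by simp, by simp, by simp [hc], by simp⟩
  · rintro ⟨a, b, c, e, h1, h2, h3, h4⟩
    have hdet := g.det_coe
    rw [Matrix.det_fin_two, h1, h2, h3, h4] at hdet
    refine ⟨⟨!![a, b; N * c, e], ?_⟩, ?_, ?_⟩
    · rw [Matrix.det_fin_two_of]
      exact_mod_cast hdet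
    · show (((N : ℤ) * c : ℤ) : ZMod N) = 0
      simp
    · ext i j
      fin_cases i <;> fin_cases j
      · exact h1.symm
      · exact h2.symm
      · refine Eq.trans ?_ h3.symm
        show (((N : ℤ) * c : ℤ) : ℝ) = _
        push_cast; rfl
      · exact h4.symm

lemma mem_normalizer_of_conj {N : ℕ} {g : SL(2, ℝ)}
    (h : ∀ γ ∈ Gamma0R N, g * γ * g⁻¹ ∈ Gamma0R N)
    (h' : ∀ γ ∈ Gamma0R N, g⁻¹ * γ * g ∈ Gamma0R N) :
    g ∈ Subgroup.normalizer (Gamma0R N : Set SL(2, ℝ)) := by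
  rw [Subgroup.mem_normalizer_iff]
  refine fun γ => ⟨h γ, fun hγ => ?_⟩
  have := h' _ hγ
  rwa [show g⁻¹ * (g * γ * g⁻¹) * g = γ by group] at this

/-- The matrix `(1/√d) (A d, B; N C, D d)` of determinant `1`. -/
def atkinLehnerMatrix (N d : ℕ) (A B C D : ℤ) (hd : d ≠ 0)
    (hdet : (A * d) * (D * d) - B * (N * C) = d) : SL(2, ℝ) :=
  ⟨(Real.sqrt d)⁻¹ • !![(A * d : ℝ), (B : ℝ); (N * C : ℝ), (D * d : ℝ)], by
    have h0 : (d : ℝ) ≠ 0 := by exact_mod_cast hd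
    have h1 : ((A * d) * (D * d) - B * (N * C) : ℝ) = d := by exact_mod_cast hdet
    rw [Matrix.det_smul, Matrix.det_fin_two_of, h1, Fintype.card_fin, inv_pow,
      Real.sq_sqrt (Nat.cast_nonneg d), inv_mul_cancel₀ h0]⟩

lemma atkinLehnerMatrix_inv (N d : ℕ) (A B C D : ℤ) (hd : d ≠ 0)
    (hdet : (A * d) * (D * d) - B * (N * C) = d) :
    (atkinLehnerMatrix N d A B C D hd hdet)⁻¹ =
      atkinLehnerMatrix N d D (-B) (-C) A hd (by linear_combination hdet) := by
  ext i j
  rw [Matrix.SpecialLinearGroup.SL2_inv_expl]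
  fin_cases i <;> fin_cases j <;> simp [atkinLehnerMatrix]

lemma atkinLehnerMatrix_conj (N d : ℕ) (A B C D : ℤ) (hd : d ≠ 0)
    (hdet : (A * d) * (D * d) - B * (N * C) = d) (hdN : d ∣ N) (γ : SL(2, ℝ))
    (hγ : γ ∈ Gamma0R N) :
    atkinLehnerMatrix N d A B C D hd hdet * γ * (atkinLehnerMatrix N d A B C D hd hdet)⁻¹ ∈
      Gamma0R N := by
  rw [atkinLehnerMatrix_inv]
  obtain ⟨a, b, c, e, h1, h2, h3, h4⟩ := mem_Gamma0R_iff.1 hγ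
  obtain ⟨M, rfl⟩ := hdN
  have h0 : (d : ℝ) ≠ 0 := by exact_mod_cast hd
  have hs : (Real.sqrt d)⁻¹ * (Real.sqrt d)⁻¹ = (d : ℝ)⁻¹ := by
    rw [← mul_inv, Real.mul_self_sqrt (Nat.cast_nonneg d)]
  rw [mem_Gamma0R_iff]
  refine ⟨(A * d * a + B * (d * M) * c) * D - (A * d * b + B * e) * M * C,
    -(A * a * B) - B ^ 2 * M * c + (A * d * b + B * e) * A,
    (C * a + D * d * c) * D - (M * C * b + D * e) * C,
    -(M * C * a + D * (d * M) * c) * B + (d * M * C * b + D * d * e) * A, ?_, ?_, ?_, ?_⟩ <;>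
  · rw [mul_entry, mul_entry, mul_entry, h1, h2, h3, h4]
    simp only [atkinLehnerMatrix, Matrix.smul_apply, Matrix.of_apply, Matrix.cons_val_zero,
      Matrix.cons_val_one, Matrix.cons_val', Matrix.cons_val_fin_one, smul_eq_mul]
    have hs' := hs
    generalize (Real.sqrt d)⁻¹ = s at hs'
    have hs2 : s ^ 2 = (d : ℝ)⁻¹ := by rw [sq, hs']
    push_cast
    ring_nf
    rw [hs2]
    field_simp
    try ring

/-- The Atkin–Lehner automorphism `w_d` of `X₀(N)` given by the matrix
`(1/√d) (A d, B; N C, D d)` of determinant `1`. -/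
def atkinLehner {N d : ℕ} [NeZero N] (hd : d ∣ N) (A B C D : ℤ)
    (hdet : (A * d) * (D * d) - B * (N * C) = d) :
    complexFunctionField N ≃ₐ[ℂ] complexFunctionField N :=
  normalizerAut ⟨atkinLehnerMatrix N d A B C D (ne_zero_of_dvd_ne_zero (NeZero.ne N) hd) hdet,
    mem_normalizer_of_conj (atkinLehnerMatrix_conj N d A B C D _ hdet hd) (by
      intro γ hγ
      have h := atkinLehnerMatrix_conj N d D (-B) (-C) A
        (ne_zero_of_dvd_ne_zero (NeZero.ne N) hd) (by linear_combination hdet) hd γ hγ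
      rw [← atkinLehnerMatrix_inv N d A B C D _ hdet, inv_inv] at h
      exact h)⟩

/-- `ν₂ = 2 ^ min(3, ⌊e₂/2⌋)`, where `2 ^ e₂` is the exact power of `2` dividing `N`. -/
def nu2 (N : ℕ) : ℕ := 2 ^ min 3 (padicValNat 2 N / 2)

/-- `ν₃ = 3 ^ min(1, ⌊e₃/2⌋)`, where `3 ^ e₃` is the exact power of `3` dividing `N`. -/
def nu3 (N : ℕ) : ℕ := 3 ^ min 1 (padicValNat 3 N / 2)

lemma dvd_of_dvd_nu {N d : ℕ} (hd : d ∣ nu2 N ∨ d ∣ nu3 N) : d ∣ 24 ∧ d * d ∣ N := by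
  have aux : ∀ p m k : ℕ, p.Prime → d ∣ p ^ min m (padicValNat p N / 2) → d ∣ p ^ m ∧ d * d ∣ N := by
    intro p m k _ h
    refine ⟨h.trans (pow_dvd_pow _ (min_le_left _ _)), ?_⟩
    refine (mul_dvd_mul h h).trans ?_
    rw [← pow_add]
    refine (pow_dvd_pow p ?_).trans pow_padicValNat_dvd
    omega
  rcases hd with h | h
  · obtain ⟨h1, h2⟩ := aux 2 3 0 Nat.prime_two h
    exact ⟨h1.trans (by norm_num), h2⟩
  · obtain ⟨h1, h2⟩ := aux 3 1 0 Nat.prime_three h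
    exact ⟨h1.trans (by norm_num), h2⟩

lemma transl_inv (x : ℝ) : (transl x)⁻¹ = transl (-x) := by
  ext i j
  rw [Matrix.SpecialLinearGroup.SL2_inv_expl]
  fin_cases i <;> fin_cases j <;> simp [transl]

lemma dvd_sub_of_dvd_mul_sub_one {d : ℕ} (hd : d ∣ 24) {a e : ℤ} (h : (d : ℤ) ∣ a * e - 1) :
    (d : ℤ) ∣ e - a := by
  have hu : ∀ d ∈ Nat.divisors 24, ∀ x y : ZMod d, x * y = 1 → y = x := by
    intro d hd
    rw [show Nat.divisors 24 = {1, 2, 3, 4, 6, 8, 12, 24} by decide] at hd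
    simp only [Finset.mem_insert, Finset.mem_singleton] at hd
    rcases hd with rfl | rfl | rfl | rfl | rfl | rfl | rfl | rfl <;> decide
  have h1 := (ZMod.intCast_zmod_eq_zero_iff_dvd _ d).2 h
  rw [← ZMod.intCast_zmod_eq_zero_iff_dvd]
  push_cast at h1 ⊢
  rw [sub_eq_zero] at h1 ⊢
  exact hu d (Nat.mem_divisors.2 ⟨hd, by norm_num⟩) _ _ h1

lemma transl_conj {N d : ℕ} [NeZero N] (h24 : d ∣ 24) (hdN : d * d ∣ N) (ε : ℤ) (γ : SL(2, ℝ))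
    (hγ : γ ∈ Gamma0R N) : transl (ε / d) * γ * (transl (ε / d))⁻¹ ∈ Gamma0R N := by
  rw [transl_inv]
  obtain ⟨a, b, c, e, h1, h2, h3, h4⟩ := mem_Gamma0R_iff.1 hγ
  have hdet := γ.det_coe
  rw [Matrix.det_fin_two, h1, h2, h3, h4] at hdet
  have hdet' : a * e - b * (N * c) = 1 := by exact_mod_cast hdet
  obtain ⟨M, rfl⟩ := hdN
  have hd : d ≠ 0 := by rintro rfl; norm_num at h24
  have h0 : (d : ℝ) ≠ 0 := by exact_mod_cast hd
  obtain ⟨t, ht⟩ : (d : ℤ) ∣ e - a := dvd_sub_of_dvd_mul_sub_one h24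
    ⟨b * (d * M * c), by push_cast at hdet'; linear_combination hdet'⟩
  have ht' : (e : ℝ) = a + d * t := by
    have : e = a + d * t := by linear_combination ht
    exact_mod_cast this
  rw [mem_Gamma0R_iff]
  refine ⟨a + ε * (d * M * c), b + ε * t - ε ^ 2 * (M * c), c, e - ε * (d * M * c),
    ?_, ?_, ?_, ?_⟩ <;>
  · rw [mul_entry, mul_entry, mul_entry, h1, h2, h3, h4]
    simp only [transl, Matrix.of_apply, Matrix.cons_val_zero,
      Matrix.cons_val_one, Matrix.cons_val', Matrix.cons_val_fin_one]
    push_cast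
    try rw [ht']
    try field_simp
    try ring

/-- The automorphism `S_d` of `X₀(N)` given by the matrix `(1, 1/d; 0, 1)`, for `d` dividing `ν₂`
or `ν₃`. -/
def translationAut {N d : ℕ} [NeZero N] (hd : d ∣ nu2 N ∨ d ∣ nu3 N) :
    complexFunctionField N ≃ₐ[ℂ] complexFunctionField N :=
  normalizerAut ⟨transl (1 / d), mem_normalizer_of_conj
    (by
      have h := transl_conj (dvd_of_dvd_nu hd).1 (dvd_of_dvd_nu hd).2 1
      simpa using h)
    (by
      have h := transl_conj (dvd_of_dvd_nu hd).1 (dvd_of_dvd_nu hd).2 (-1)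
      intro γ hγ
      have h' := h γ hγ
      rw [transl_inv]
      rw [transl_inv] at h'
      convert h' using 4 <;> push_cast <;> ring)⟩

end ModularCurve

end

/-!
The field `ℂ(X₀(N))` is generated over `ℂ` by `j(z)` and `j(Nz)` (`mem_adjoin_jX_jNX`), and both
functions have rational Fourier coefficients, since `j = E₄³ / Δ` with `1728 Δ = E₄³ - E₆²`
(`exists_hasQExp_jMero`). All statements about fields of definition follow from these two facts.

*Generation.* A meromorphic function of level one that is of exponential growth at `i∞` has finitely
many poles in the standard fundamental domain. Multiplying by a product of powers of `j - j(p)`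
removes them, and a holomorphic function of level one with exponential growth is a polynomial in
`j`, as one sees by subtracting multiples of powers of `j` and using that modular forms of weight
zero and level one are constant. So it is a rational function of `j` (`mem_adjoin_jMero`). For
`φ` in `ℂ(X₀(N))`, Lagrange interpolation over the cosets of `Γ₀(N)` in `SL₂(ℤ)` expresses `φ` as a
rational function of `j(Nz)` whose coefficients are of level one (`mem_of_lagrange`). It applies
because `j(Nz)` is different from its other conjugates (`mem_Gamma0R_of_pullback_eq`).

*Descent.* For a subfield `K` of `ℂ`, the field `K(X₀(N))` consists of the functions with all
Fourier coefficients in `K`, and is generated over `K` by `j(z)` and `j(Nz)`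
(`mem_functionFieldOver_iff`, `functionFieldOver_eq_adjoin`): if `φ = P / Q` with polynomials `P`,
`Q` in `j(z)` and `j(Nz)` over `ℂ`, and `φ` has coefficients in `K`, then applying a `K`-linear map
`ℂ → K` to the coefficients in `φ Q = P` replaces `P` and `Q` by polynomials over `K`.

*Automorphisms.* Up to elements of `SL₂(ℤ)` on the left, `w_d` carries `j(z)` to `j(dz)` and `j(Nz)`
to `j((N/d)z)`, which have rational coefficients, so `w_d` is defined over `ℚ`. The translation
`S_d` multiplies the `n`-th Fourier coefficient by `exp(2πi/d)^n`. Hence it is defined over every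
field `K` containing `exp(2πi/d)`, and over no other field, because `j = q⁻¹ + ⋯` is mapped to a
function with the coefficient `exp(2πi/d)⁻¹` at `q⁻¹` (`isDefinedOver_translationAut_iff`).
-/

open scoped Manifold ModularForm

noncomputable section

namespace ModularCurve

/-! ### Representatives of meromorphic functions on the upper half-plane -/

lemma eventually_nhdsNE_of_codiscrete {p : ℍ → Prop} (h : ∀ᶠ z in codiscrete ℍ, p z) (z : ℍ) :
    ∀ᶠ w in 𝓝[≠] z, p w := by
  have := mem_codiscrete.1 h z
  rwa [disjoint_principal_right, compl_compl] at this

instance nhdsNE_neBot (z : ℍ) : NeBot (𝓝[≠] z) := by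
  refine ⟨fun h => ?_⟩
  have h1 := isOpenEmbedding_coe.isOpenMap _ ((isOpen_singleton_iff_punctured_nhds z).2 h)
  rw [Set.image_singleton] at h1
  exact not_isOpen_singleton _ h1

/-- A set with discrete closed complement meets every neighbourhood of `i∞`. -/
lemma frequently_atImInfty_of_codiscrete {p : ℍ → Prop} (h : ∀ᶠ z in codiscrete ℍ, p z) :
    ∃ᶠ z in atImInfty, p z := by
  intro hn
  obtain ⟨A, hA⟩ := (atImInfty_mem _).1 hn
  let w : ℍ := ⟨Complex.I * (max A 0 + 1 : ℝ), by
    simp only [Complex.mul_im, Complex.I_re, Complex.I_im, Complex.ofReal_re, Complex.ofReal_im]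
    have := le_max_right A 0
    linarith⟩
  have hw : A < w.im := by
    have : w.im = max A 0 + 1 := by simp [w, UpperHalfPlane.im]
    have := le_max_left A 0
    linarith
  have h1 := eventually_nhdsNE_of_codiscrete h w
  have h2 : ∀ᶠ z : ℍ in 𝓝[≠] w, A < z.im :=
    ((UpperHalfPlane.continuous_im.tendsto w).eventually (lt_mem_nhds hw)).filter_mono
      nhdsWithin_le_nhds
  obtain ⟨z, hz1, hz2⟩ := (h1.and h2).exists
  exact hA z hz2.le hz1

/-- Two continuous functions agreeing off a closed discrete set are equal. -/
lemma eq_of_germ_eq {f g : ℍ → ℂ} (hf : Continuous f) (hg : Continuous g)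
    (h : (f : FunGerm) = (g : FunGerm)) : f = g := by
  funext z
  have h1 := eventually_nhdsNE_of_codiscrete (Germ.coe_eq.1 h) z
  exact tendsto_nhds_unique_of_eventuallyEq ((hf.tendsto z).mono_left nhdsWithin_le_nhds)
    ((hg.tendsto z).mono_left nhdsWithin_le_nhds) h1

/-- A holomorphic function on `ℍ` as an element of the field of meromorphic functions. -/
def ofHolo (f : ℍ → ℂ) (hf : MDiff f) : Mero :=
  ⟨(f : FunGerm), f, rfl, fun z =>
    ((UpperHalfPlane.mdifferentiable_iff.1 hf).analyticAt
      (isOpen_upperHalfPlaneSet.mem_nhds z.2)).meromorphicAt⟩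

lemma coe_ofHolo (f : ℍ → ℂ) (hf : MDiff f) : ((ofHolo f hf : Mero) : FunGerm) = f := rfl

lemma germ_pullback {φ : Mero} {f : ℍ → ℂ} (h : (f : FunGerm) = φ) (g : SL(2, ℝ)) :
    ((fun z => f (g • z) : ℍ → ℂ) : FunGerm) = (pullback g φ : Mero) := by
  obtain ⟨φ, hφ⟩ := φ
  subst h
  rfl

lemma germ_mul {φ ψ : Mero} {f g : ℍ → ℂ} (hf : (f : FunGerm) = φ) (hg : (g : FunGerm) = ψ) :
    ((f * g : ℍ → ℂ) : FunGerm) = (φ * ψ : Mero) := by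
  rw [Germ.coe_mul, hf, hg]; rfl

lemma germ_add {φ ψ : Mero} {f g : ℍ → ℂ} (hf : (f : FunGerm) = φ) (hg : (g : FunGerm) = ψ) :
    ((f + g : ℍ → ℂ) : FunGerm) = (φ + ψ : Mero) := by
  rw [Germ.coe_add, hf, hg]; rfl

lemma germ_algebraMap (c : ℂ) :
    ((fun _ => c : ℍ → ℂ) : FunGerm) = (algebraMap ℂ Mero c : Mero) :=
  (algebraMap_eq c).symm

/-! ### Laurent expansions at the cusp `∞` -/

lemma qParam_ne_zero (h : ℝ) (z : ℂ) : Function.Periodic.qParam h z ≠ 0 := Complex.exp_ne_zero _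

lemma tendsto_qParam_atImInfty {h : ℝ} (hh : 0 < h) :
    Tendsto (fun z : ℍ => Function.Periodic.qParam h z) atImInfty (𝓝[≠] 0) :=
  (Function.Periodic.qParam_tendsto hh).comp tendsto_coe_atImInfty

lemma hasSum_laurent_mul {P Q : LaurentSeries ℂ} {q s t : ℂ} (hq : q ≠ 0)
    (hs : HasSum (fun n : ℤ => P.coeff n * q ^ n) s)
    (ht : HasSum (fun n : ℤ => Q.coeff n * q ^ n) t) :
    HasSum (fun n : ℤ => (P * Q).coeff n * q ^ n) (s * t) := by
  have hsm : Summable fun x : ℤ × ℤ => P.coeff x.1 * q ^ x.1 * (Q.coeff x.2 * q ^ x.2) :=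
    summable_mul_of_summable_norm (R := ℂ) (f := fun n : ℤ => P.coeff n * q ^ n)
      (g := fun n : ℤ => Q.coeff n * q ^ n) hs.summable.norm ht.summable.norm
  have h1 := hs.mul ht hsm
  -- the pairs `(i, j)` are fibred over `k = i + j`
  let e : (Σ _ : ℤ, ℤ) ≃ ℤ × ℤ :=
    { toFun := fun x => (x.2, x.1 - x.2)
      invFun := fun y => ⟨y.1 + y.2, y.1⟩
      left_inv := fun x => by simp
      right_inv := fun y => by simp }
  have h2 := (e.hasSum_iff).2 h1
  refine h2.sigma fun k => ?_
  have hinj : Set.InjOn Prod.fst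
      (Finset.antidiagonal P.isPWO_support Q.isPWO_support k : Set (ℤ × ℤ)) := by
    intro x hx y hy hxy
    rw [Finset.mem_coe, Finset.mem_antidiagonal] at hx hy
    have := hx.2.2.trans hy.2.2.symm
    exact Prod.ext hxy (by omega)
  have h3 : (P * Q).coeff k * q ^ k =
      ∑ i ∈ (Finset.antidiagonal P.isPWO_support Q.isPWO_support k).image Prod.fst,
        P.coeff i * q ^ i * (Q.coeff (k - i) * q ^ (k - i)) := by
    rw [Finset.sum_image hinj, HahnSeries.coeff_mul, Finset.sum_mul]
    refine Finset.sum_congr rfl fun x hx => ?_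
    rw [Finset.mem_antidiagonal] at hx
    rw [← hx.2.2, add_sub_cancel_left, zpow_add₀ hq]
    ring
  rw [h3]
  refine hasSum_sum_of_ne_finset_zero fun i hi => ?_
  by_contra hne
  apply hi
  rw [Finset.mem_image]
  refine ⟨(i, k - i), Finset.mem_antidiagonal.2 ⟨?_, ?_, by simp⟩, rfl⟩
  · exact fun h => hne (by simp [e, h])
  · exact fun h => hne (by simp [e, h])

/-- `P` is the Laurent expansion of `φ` in `q = exp(2πiz)` at the cusp `∞`. -/
def HasQExp (φ : Mero) (P : LaurentSeries ℂ) : Prop :=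
  ∃ f : ℍ → ℂ, (f : FunGerm) = φ ∧ ∀ᶠ z : ℍ in atImInfty,
    HasSum (fun n : ℤ => P.coeff n * Function.Periodic.qParam 1 z ^ n) (f z)

lemma HasQExp.mul {φ ψ : Mero} {P Q : LaurentSeries ℂ} (h : HasQExp φ P) (h' : HasQExp ψ Q) :
    HasQExp (φ * ψ) (P * Q) := by
  obtain ⟨f, hf, hP⟩ := h
  obtain ⟨g, hg, hQ⟩ := h'
  refine ⟨f * g, germ_mul hf hg, ?_⟩
  filter_upwards [hP, hQ] with z h1 h2
  exact hasSum_laurent_mul (qParam_ne_zero _ _) h1 h2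

lemma HasQExp.add {φ ψ : Mero} {P Q : LaurentSeries ℂ} (h : HasQExp φ P) (h' : HasQExp ψ Q) :
    HasQExp (φ + ψ) (P + Q) := by
  obtain ⟨f, hf, hP⟩ := h
  obtain ⟨g, hg, hQ⟩ := h'
  refine ⟨f + g, germ_add hf hg, ?_⟩
  filter_upwards [hP, hQ] with z h1 h2
  simpa [add_mul] using h1.add h2

lemma hasQExp_algebraMap (c : ℂ) : HasQExp (algebraMap ℂ Mero c) (HahnSeries.C c) := by
  refine ⟨fun _ => c, germ_algebraMap c, Eventually.of_forall fun z => ?_⟩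
  have := hasSum_ite_eq (0 : ℤ) c
  refine this.congr_fun fun n => ?_
  by_cases hn : n = 0 <;> simp [HahnSeries.C_apply, hn]

/-- A meromorphic function vanishing identically has no other expansion than `0`, by the
isolation of the zeros of a nonzero power series. -/
lemma HasQExp.eq_zero {P : LaurentSeries ℂ} (h : HasQExp 0 P) : P = 0 := by
  obtain ⟨f, hf, hP⟩ := h
  have hf0 : ∀ᶠ z in codiscrete ℍ, f z = 0 := Germ.coe_eq.1 hf
  set k := P.order
  let c : ℕ → ℂ := fun n => P.coeff (k + n)
  have hsum : ∀ᶠ z : ℍ in atImInfty, HasSum (fun n : ℕ => c n * Function.Periodic.qParam 1 z ^ n)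
      (f z * Function.Periodic.qParam 1 z ^ (-k)) := by
    filter_upwards [hP] with z hz
    have hinj : Function.Injective (fun n : ℕ => k + (n : ℤ)) := fun a b hab => by
      simpa using hab
    have h1 := (hinj.hasSum_iff (fun m hm => ?_)).2 hz
    · refine (h1.mul_right (Function.Periodic.qParam 1 z ^ (-k))).congr_fun fun n => ?_
      simp only [Function.comp_apply, c]
      rw [mul_assoc, ← zpow_add₀ (qParam_ne_zero _ _), add_neg_cancel_comm, zpow_natCast]
    · have : m < k := by
        by_contra hlt
        exact hm ⟨(m - k).toNat, by simp only; omega⟩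
      rw [HahnSeries.coeff_eq_zero_of_lt_order this, zero_mul]
  let p := FormalMultilinearSeries.ofScalars ℂ c
  have hrad : 0 < p.radius := by
    obtain ⟨z, hz⟩ := hsum.exists
    refine lt_of_lt_of_le ?_ (p.le_radius_of_summable_norm
      (r := ‖Function.Periodic.qParam 1 (z : ℂ)‖₊) ?_)
    · simpa using qParam_ne_zero 1 (z : ℂ)
    · refine hz.summable.norm.congr fun n => ?_
      simp [p, norm_pow]
  have hps := (p.hasFPowerSeriesOnBall hrad).hasFPowerSeriesAt
  have hq := tendsto_qParam_atImInfty one_pos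
  have heq : ∀ᶠ z : ℍ in atImInfty, p.sum (Function.Periodic.qParam 1 z) =
      f z * Function.Periodic.qParam 1 z ^ (-k) := by
    filter_upwards [hsum] with z hz
    rw [← hz.tsum_eq, FormalMultilinearSeries.sum]
    refine tsum_congr fun n => ?_
    simp [p, mul_comm]
  rcases hps.analyticAt.eventually_eq_zero_or_eventually_ne_zero with h0 | h0
  · have hp : p = 0 := hps.locally_zero_iff.1 h0
    have hc : c 0 = 0 := by
      have := congrFun hp 0
      have := congrArg (fun l => l (fun _ => (1 : ℂ))) this
      simpa [p, FormalMultilinearSeries.ofScalars_apply_eq] using this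
    exact HahnSeries.coeff_order_eq_zero.1 (by simpa only [c, Nat.cast_zero, add_zero] using hc)
  · exfalso
    obtain ⟨z, hz0, hz1, hz2⟩ := ((frequently_atImInfty_of_codiscrete hf0).and_eventually
      ((hq.eventually h0).and heq)).exists
    exact hz1 (by rw [hz2, hz0, zero_mul])

lemma HasQExp.neg {φ : Mero} {P : LaurentSeries ℂ} (h : HasQExp φ P) : HasQExp (-φ) (-P) := by
  have := (hasQExp_algebraMap (-1)).mul h
  have h2 : HahnSeries.C (-1 : ℂ) * P = -P := by
    rw [map_neg, map_one]
    exact neg_one_mul P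
  rwa [h2, map_neg, map_one, neg_one_mul] at this

lemma HasQExp.unique {φ : Mero} {P Q : LaurentSeries ℂ} (h : HasQExp φ P) (h' : HasQExp φ Q) :
    P = Q := by
  have := h.add h'.neg
  rw [add_neg_cancel] at this
  simpa [add_neg_eq_zero] using this.eq_zero

/-- A function that is meromorphic in `q` at `q = 0` has a Laurent expansion. -/
lemma IsMeroAtInfty.exists_hasQExp {φ : Mero} (h : IsMeroAtInfty 1 φ) : ∃ P, HasQExp φ P := by
  obtain ⟨f, hf, G, ⟨n, p, hp⟩, hG⟩ := h
  refine ⟨HahnSeries.single (-n : ℤ) 1 * HahnSeries.ofPowerSeries ℤ ℂ (PowerSeries.mk p.coeff),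
    f, hf, ?_⟩
  filter_upwards [hG, (tendsto_qParam_atImInfty one_pos).eventually
    (hp.eventually_hasSum.filter_mono nhdsWithin_le_nhds)] with z h1 h2
  rw [h1]
  set q := Function.Periodic.qParam 1 (z : ℂ)
  have hq : q ≠ 0 := qParam_ne_zero _ _
  have hinj : Function.Injective (fun k : ℕ => (k : ℤ) - n) := fun a b hab => by simpa using hab
  refine (hinj.hasSum_iff (fun m hm => ?_)).1 ?_
  · rw [HahnSeries.coeff_single_mul, one_mul, HahnSeries.ofPowerSeries_apply,
      HahnSeries.embDomain_of_notMem_range, zero_mul]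
    rintro ⟨k, hk⟩
    refine hm ⟨k, ?_⟩
    have : (k : ℤ) = m - -n := hk
    simp only
    omega
  · simp only [zero_add, sub_zero, smul_eq_mul] at h2
    have h3 := h2.mul_left (q ^ (-n : ℤ))
    rw [← mul_assoc, ← zpow_natCast, ← zpow_add₀ hq, neg_add_cancel, zpow_zero, one_mul] at h3
    refine h3.congr_fun fun k => ?_
    simp only [Function.comp_apply, HahnSeries.coeff_single_mul, one_mul, sub_neg_eq_add,
      sub_add_cancel, HahnSeries.ofPowerSeries_apply_coeff, PowerSeries.coeff_mk]
    rw [p.apply_eq_pow_smul_coeff, smul_eq_mul, zpow_sub₀ hq, zpow_neg, zpow_natCast, zpow_natCast]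
    field_simp

lemma transl_one_mem (N : ℕ) : transl 1 ∈ Gamma0R N :=
  mem_Gamma0R_iff.2 ⟨1, 1, 0, 1, by simp [transl], by simp [transl], by simp [transl],
    by simp [transl]⟩

lemma exists_hasQExp {N : ℕ} (φ : complexFunctionField N) : ∃ P, HasQExp φ P := by
  have := φ.2.2 1 1 one_pos (by simpa using transl_one_mem N)
  rw [pullback_one] at this
  exact this.exists_hasQExp

/-- The `q`-expansion at `∞`, as a homomorphism from `ℂ(X₀(N))` to Laurent series. -/
def qExp (N : ℕ) : complexFunctionField N →+* LaurentSeries ℂ where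
  toFun φ := (exists_hasQExp φ).choose
  map_one' := (exists_hasQExp (1 : complexFunctionField N)).choose_spec.unique <| by
    simpa using hasQExp_algebraMap 1
  map_zero' := (exists_hasQExp (0 : complexFunctionField N)).choose_spec.unique <| by
    simpa using hasQExp_algebraMap 0
  map_mul' φ ψ := (exists_hasQExp (φ * ψ)).choose_spec.unique
    ((exists_hasQExp φ).choose_spec.mul (exists_hasQExp ψ).choose_spec)
  map_add' φ ψ := (exists_hasQExp (φ + ψ)).choose_spec.unique
    ((exists_hasQExp φ).choose_spec.add (exists_hasQExp ψ).choose_spec)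

lemma hasQExp_qExp {N : ℕ} (φ : complexFunctionField N) : HasQExp φ (qExp N φ) :=
  (exists_hasQExp φ).choose_spec

lemma qExp_eq {N : ℕ} {φ : complexFunctionField N} {P : LaurentSeries ℂ} (h : HasQExp φ P) :
    qExp N φ = P :=
  (hasQExp_qExp φ).unique h

lemma qExp_algebraMap {N : ℕ} (c : ℂ) :
    qExp N (algebraMap ℂ (complexFunctionField N) c) = HahnSeries.C c :=
  qExp_eq (hasQExp_algebraMap c)

/-! ### The modular invariant `j` -/

/-- The canonical map `SL₂(ℤ) → SL₂(ℝ)`. -/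
abbrev toReal : SL(2, ℤ) →* SL(2, ℝ) := Matrix.SpecialLinearGroup.map (Int.castRingHom ℝ)

lemma periodic_comp_ofComplex {f : ℍ → ℂ} {h : ℝ} (hper : ∀ z : ℍ, f (h +ᵥ z) = f z) :
    Function.Periodic (f ∘ ofComplex) h := by
  intro w
  by_cases hw : 0 < w.im
  · have hw' : 0 < (w + h).im := by simpa using hw
    have e : (⟨w + h, hw'⟩ : ℍ) = h +ᵥ (⟨w, hw⟩ : ℍ) := by
      ext; simp [add_comm]
    simp only [Function.comp_apply, ofComplex_apply_of_im_pos hw', ofComplex_apply_of_im_pos hw]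
    rw [e, hper]
  · have hw' : (w + h).im ≤ 0 := by simpa using hw
    simp [ofComplex_apply_of_im_nonpos hw', ofComplex_apply_of_im_nonpos (not_lt.1 hw)]

/-- The function `exp(2πiz/h)` on `ℍ`. -/
def qFun (h : ℝ) (z : ℍ) : ℂ := Function.Periodic.qParam h z

lemma qFun_ne_zero (h : ℝ) (z : ℍ) : qFun h z ≠ 0 := qParam_ne_zero _ _

lemma norm_qFun (h : ℝ) (z : ℍ) : ‖qFun h z‖ = Real.exp (-2 * Real.pi * z.im / h) := by
  rw [qFun, Function.Periodic.norm_qParam, coe_im]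

lemma mdifferentiable_qFun (h : ℝ) : MDiff (qFun h) := by
  rw [UpperHalfPlane.mdifferentiable_iff]
  refine DifferentiableOn.congr (f := Function.Periodic.qParam h) ?_ fun z hz => ?_
  · exact (Function.Periodic.differentiable_qParam).differentiableOn
  · simp [qFun, ofComplex_apply_of_im_pos hz]

lemma qFun_vadd {h : ℝ} (hh : h ≠ 0) (z : ℍ) : qFun h (h +ᵥ z) = qFun h z := by
  simp only [qFun, Function.Periodic.qParam, coe_vadd]
  rw [mul_add, add_div, mul_div_cancel_right₀ _ (by exact_mod_cast hh), Complex.exp_add,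
    Complex.exp_two_pi_mul_I, one_mul]

/-- A holomorphic function on `ℍ` that is `h`-periodic and of at most exponential growth at `i∞` is
a meromorphic function of `exp(2πiz/h)` near `i∞`, by Riemann's theorem on removable
singularities. -/
lemma exists_meromorphicAt_of_periodic {f : ℍ → ℂ} (hf : MDiff f) {h : ℝ} (hh : 0 < h)
    (hper : ∀ z : ℍ, f (h +ᵥ z) = f z) {C : ℝ}
    (hgr : f =O[atImInfty] fun z => Real.exp (C * z.im)) :
    ∃ G : ℂ → ℂ, MeromorphicAt G 0 ∧ ∀ z : ℍ, f z = G (Function.Periodic.qParam h z) := by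
  -- `exp(2πinz/h)` has absolute value `exp(-2πn Im z / h)`, so this `n` makes the product bounded
  obtain ⟨n, hn⟩ := exists_nat_ge (C * h / (2 * Real.pi))
  let g : ℍ → ℂ := f * qFun h ^ n
  have hg : MDiff g := hf.mul ((mdifferentiable_qFun h).pow n)
  have hgper : Function.Periodic (g ∘ ofComplex) h := periodic_comp_ofComplex fun z => by
    simp only [g, Pi.mul_apply, Pi.pow_apply, hper, qFun_vadd hh.ne']
  have hgb : IsBoundedAtImInfty g := by
    rw [IsBoundedAtImInfty, BoundedAtFilter]
    have h1 : (fun z : ℍ => Real.exp (C * z.im) * ‖qFun h z ^ n‖) =O[atImInfty] (1 : ℍ → ℝ) := by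
      refine Asymptotics.IsBigO.of_bound 1 (Eventually.of_forall fun z => ?_)
      rw [norm_pow, norm_qFun, ← Real.exp_nat_mul, ← Real.exp_add,
        Real.norm_of_nonneg (Real.exp_pos _).le]
      simp only [Pi.one_apply, norm_one, mul_one]
      rw [Real.exp_le_one_iff]
      have h2 : C ≤ n * (2 * Real.pi / h) := by
        rw [div_le_iff₀ (by positivity)] at hn
        rw [mul_div_assoc', le_div_iff₀ hh]
        linarith
      have h3 := mul_le_mul_of_nonneg_right h2 z.im_pos.le
      have h4 : (n : ℝ) * (-2 * Real.pi * z.im / h) = -(n * (2 * Real.pi / h) * z.im) := by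
        ring
      rw [h4]
      linarith
    exact (hgr.mul (Asymptotics.isBigO_refl (fun z => qFun h z ^ n) _).norm_right).trans h1
  have hA := analyticAt_cuspFunction_zero hh hgper hg hgb
  refine ⟨fun w => (w ^ n)⁻¹ * cuspFunction h g w, ?_, fun z => ?_⟩
  · exact ((MeromorphicAt.id 0).pow n).inv.mul hA.meromorphicAt
  · have hz : qFun h z ^ n ≠ 0 := pow_ne_zero _ (qFun_ne_zero _ _)
    simp only
    rw [eq_cuspFunction z hh.ne' hgper]
    change f z = (qFun h z ^ n)⁻¹ * (f z * qFun h z ^ n)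
    field_simp

open ModularForm (E₄ E₆ discriminant discriminant_ne_zero)

/-- The modular invariant `j = E₄³ / Δ`. -/
def jFun (z : ℍ) : ℂ := E₄ z ^ 3 / discriminant z

lemma levelOne_smul {F : Type*} [FunLike F ℍ ℂ] {k : ℤ} [SlashInvariantFormClass F 𝒮ℒ k] (f : F)
    (γ : SL(2, ℤ)) (z : ℍ) : f (γ • z) = denom (toReal γ : GL (Fin 2) ℝ) z ^ k * f z :=
  SlashInvariantForm.slash_action_eqn'' (Γ := 𝒮ℒ) f (MonoidHom.mem_range.2 ⟨γ, rfl⟩) z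

lemma jFun_smul (γ : SL(2, ℤ)) (z : ℍ) : jFun (toReal γ • z) = jFun z := by
  have h1 := levelOne_smul E₄ γ z
  have h2 := levelOne_smul CuspForm.discriminant γ z
  have h0 := discriminant_ne_zero z
  have hd : denom (toReal γ : GL (Fin 2) ℝ) z ≠ 0 := denom_ne_zero _ _
  rw [CuspForm.coe_discriminant] at h2
  change E₄ (γ • z) ^ 3 / discriminant (γ • z) = _
  rw [h1, h2, jFun]
  generalize denom (toReal γ : GL (Fin 2) ℝ) z = d at hd
  simp only [zpow_ofNat]
  field_simp

lemma mdifferentiable_jFun : MDiff jFun :=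
  ((ModularFormClass.holo E₄).pow 3).div (ModularFormClass.holo CuspForm.discriminant)
    discriminant_ne_zero

lemma tendsto_jFun_mul_qParam :
    Tendsto (fun z : ℍ => jFun z * Function.Periodic.qParam 1 z) atImInfty (𝓝 1) := by
  have hE : Tendsto E₄ atImInfty (𝓝 1) := by
    have hA : AnalyticAt ℂ (cuspFunction 1 E₄) 0 :=
      ModularFormClass.analyticAt_cuspFunction_zero E₄ one_pos one_mem_strictPeriods_SL
    have h0 : cuspFunction 1 E₄ 0 = 1 := by
      have := EisensteinSeries.E_qExpansion_coeff_zero (k := 4) (by norm_num) ⟨2, rfl⟩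
      rw [qExpansion_coeff] at this
      simpa using this
    have h1 := hA.continuousAt.tendsto.comp (qParam_tendsto_atImInfty one_pos)
    rw [h0] at h1
    refine h1.congr fun z => ?_
    exact SlashInvariantFormClass.eq_cuspFunction E₄ z one_mem_strictPeriods_SL one_ne_zero
  have hD := ModularForm.tendsto_atImInfty_tprod_one_sub_eta_q_pow
  have := (hE.pow 3).div hD one_ne_zero
  rw [one_pow, div_one] at this
  refine this.congr fun z => ?_
  rw [Pi.div_apply, jFun, ModularForm.discriminant_eq_q_prod]
  have := qParam_ne_zero 1 (z : ℂ)
  field_simp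

lemma isBigO_jFun : jFun =O[atImInfty] fun z => Real.exp (2 * Real.pi * z.im) := by
  have h1 := tendsto_jFun_mul_qParam.isBigO_one ℝ
  have h2 := h1.mul (Asymptotics.isBigO_refl
    (fun z : ℍ => (Function.Periodic.qParam 1 (z : ℂ))⁻¹) atImInfty).norm_right
  refine (h2.congr_left fun z => ?_).trans (Asymptotics.IsBigO.of_bound 1
    (Eventually.of_forall fun z => ?_))
  · rw [mul_assoc, mul_inv_cancel₀ (qParam_ne_zero _ _), mul_one]
  · simp only [one_mul, norm_inv, Function.Periodic.norm_qParam, ← Real.exp_neg]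
    rw [Real.norm_of_nonneg (Real.exp_pos _).le, Real.norm_of_nonneg (Real.exp_pos _).le, coe_im]
    refine (congrArg Real.exp ?_).le
    ring

/-- The modular invariant `j` as an element of the field of meromorphic functions. -/
def jMero : Mero := ofHolo jFun mdifferentiable_jFun

lemma pullback_jMero (γ : SL(2, ℤ)) : pullback (toReal γ) jMero = jMero := by
  refine Subtype.ext ((germ_pullback (coe_ofHolo jFun _).symm _).symm.trans ?_)
  exact congrArg Germ.ofFun (funext fun z => jFun_smul γ z)

/-! ### Rational cusps and the functions `j(z)`, `j(Nz)` on `X₀(N)` -/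

lemma det_eq_one (g : SL(2, ℝ)) : g 0 0 * g 1 1 - g 0 1 * g 1 0 = 1 := by
  have := g.det_coe
  rwa [Matrix.det_fin_two] at this

lemma toReal_apply (γ : SL(2, ℤ)) (i j : Fin 2) : toReal γ i j = (γ i j : ℝ) := by simp

lemma exists_toReal_entries {a b c d : ℤ} (h : a * d - b * c = 1) : ∃ γ : SL(2, ℤ),
    toReal γ 0 0 = a ∧ toReal γ 0 1 = b ∧ toReal γ 1 0 = c ∧ toReal γ 1 1 = d :=
  ⟨⟨!![a, b; c, d], by rw [Matrix.det_fin_two_of, h]⟩,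
    toReal_apply _ _ _, toReal_apply _ _ _, toReal_apply _ _ _, toReal_apply _ _ _⟩

lemma sl2_ext {g h : SL(2, ℝ)} (h1 : g 0 0 = h 0 0) (h2 : g 0 1 = h 0 1) (h3 : g 1 0 = h 1 0)
    (h4 : g 1 1 = h 1 1) : g = h := by
  ext i j
  fin_cases i <;> fin_cases j <;> assumption

lemma inv_entry_zero_zero (g : SL(2, ℝ)) : g⁻¹ 0 0 = g 1 1 := by
  simp [Matrix.SpecialLinearGroup.SL2_inv_expl]

lemma inv_entry_zero_one (g : SL(2, ℝ)) : g⁻¹ 0 1 = -g 0 1 := by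
  simp [Matrix.SpecialLinearGroup.SL2_inv_expl]

lemma inv_entry_one_zero (g : SL(2, ℝ)) : g⁻¹ 1 0 = -g 1 0 := by
  simp [Matrix.SpecialLinearGroup.SL2_inv_expl]

lemma inv_entry_one_one (g : SL(2, ℝ)) : g⁻¹ 1 1 = g 0 0 := by
  simp [Matrix.SpecialLinearGroup.SL2_inv_expl]

lemma transl_entries (x : ℝ) :
    transl x 0 0 = 1 ∧ transl x 0 1 = x ∧ transl x 1 0 = 0 ∧ transl x 1 1 = 1 := by
  simp [transl]

lemma coe_smul_eq (g : SL(2, ℝ)) (z : ℍ) :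
    ((g • z : ℍ) : ℂ) = ((g 0 0 : ℝ) * z + (g 0 1 : ℝ)) / ((g 1 0 : ℝ) * z + (g 1 1 : ℝ)) := by
  simp [UpperHalfPlane.specialLinearGroup_apply]

lemma coe_smul_of_upper {g : SL(2, ℝ)} (hg : g 1 0 = 0) (z : ℍ) :
    ((g • z : ℍ) : ℂ) = ((g 0 0 ^ 2 : ℝ) : ℂ) * z + ((g 0 0 * g 0 1 : ℝ) : ℂ) := by
  have h := det_eq_one g
  rw [hg, mul_zero, sub_zero] at h
  have h0 : g 1 1 ≠ 0 := right_ne_zero_of_mul_eq_one h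
  have h' : ((g 0 0 : ℝ) : ℂ) * ((g 1 1 : ℝ) : ℂ) = 1 := by exact_mod_cast h
  have h0' : ((g 1 1 : ℝ) : ℂ) ≠ 0 := by exact_mod_cast h0
  rw [coe_smul_eq, hg, div_eq_iff (by simpa using h0')]
  push_cast
  linear_combination (-((g 0 0 : ℝ) : ℂ) * z - ((g 0 1 : ℝ) : ℂ)) * h'

lemma im_smul_of_upper {g : SL(2, ℝ)} (hg : g 1 0 = 0) (z : ℍ) :
    (g • z).im = g 0 0 ^ 2 * z.im := by
  rw [← coe_im, coe_smul_of_upper hg]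
  simp only [Complex.add_im, Complex.im_ofReal_mul, Complex.ofReal_im,
    add_zero, coe_im]

lemma sq_pos_of_upper {g : SL(2, ℝ)} (hg : g 1 0 = 0) : 0 < g 0 0 ^ 2 := by
  have h := det_eq_one g
  rw [hg, mul_zero, sub_zero] at h
  have h0 := left_ne_zero_of_mul_eq_one h
  positivity

lemma tendsto_smul_of_upper {g : SL(2, ℝ)} (hg : g 1 0 = 0) :
    Tendsto (fun z : ℍ => g • z) atImInfty atImInfty := by
  rw [atImInfty, tendsto_comap_iff]
  have : (UpperHalfPlane.im ∘ fun z : ℍ => g • z) = fun z => g 0 0 ^ 2 * z.im :=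
    funext fun z => im_smul_of_upper hg z
  rw [this]
  exact tendsto_comap.const_mul_atTop (sq_pos_of_upper hg)

lemma transl_smul (x : ℝ) (z : ℍ) : transl x • z = x +ᵥ z := by
  ext
  rw [coe_smul_eq]
  simp [transl, add_comm]

/-- The point `g ∞` lies in `ℙ¹(ℚ)`: the first column of `g` is proportional to a vector of
integers. -/
def RatCusp (g : SL(2, ℝ)) : Prop := ∃ (t : ℝ) (m n : ℤ), g 0 0 = t * m ∧ g 1 0 = t * n

/-- `SL₂(ℤ)` acts transitively on `ℙ¹(ℚ)`. -/
lemma RatCusp.exists_upper {g : SL(2, ℝ)} (h : RatCusp g) :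
    ∃ γ : SL(2, ℤ), (toReal γ * g) 1 0 = 0 := by
  obtain ⟨t, m, n, hm, hn⟩ := h
  have hmn : ¬ (m = 0 ∧ n = 0) := by
    rintro ⟨rfl, rfl⟩
    have := det_eq_one g
    rw [hm, hn] at this
    simp at this
  have hd : 0 < Int.gcd m n := Int.gcd_pos_iff.2 (by tauto)
  obtain ⟨m', n', hco, hm', hn'⟩ := Int.exists_gcd_one hd
  obtain ⟨a, b, hab⟩ := Int.isCoprime_iff_gcd_eq_one.2 hco
  obtain ⟨γ, -, -, h3, h4⟩ := exists_toReal_entries (a := a) (b := b) (c := -n') (d := m')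
    (by linear_combination hab)
  refine ⟨γ, ?_⟩
  rw [mul_entry, hm, hn, h3, h4]
  have e1 : (m : ℝ) = m' * (Int.gcd m n : ℕ) := by exact_mod_cast hm'
  have e2 : (n : ℝ) = n' * (Int.gcd m n : ℕ) := by exact_mod_cast hn'
  generalize ((Int.gcd m n : ℕ) : ℝ) = k at e1 e2
  rw [e1, e2]
  push_cast
  ring

/-- The cusps of `Γ₀(N)` lie in `ℙ¹(ℚ)`: with `g = (a, *; c, *)`, the first column of
`g (1, h; 0, 1) g⁻¹ - 1` is `-h c (a, c)`. -/
lemma ratCusp_of_conj_mem {N : ℕ} {g : SL(2, ℝ)} {h : ℝ} (hh : h ≠ 0)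
    (hg : g * transl h * g⁻¹ ∈ Gamma0R N) : RatCusp g := by
  obtain ⟨a, b, c, e, h1, h2, h3, h4⟩ := mem_Gamma0R_iff.1 hg
  have hdet := det_eq_one g
  by_cases hc : g 1 0 = 0
  · exact ⟨g 0 0, 1, 0, by simp, by simp [hc]⟩
  · obtain ⟨t1, t2, t3, t4⟩ := transl_entries h
    rw [mul_entry, mul_entry, mul_entry, t1, t2, t3, t4, inv_entry_zero_zero,
      inv_entry_one_zero] at h1
    rw [mul_entry, mul_entry, mul_entry, t1, t2, t3, t4, inv_entry_zero_zero,
      inv_entry_one_zero] at h3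
    refine ⟨-1 / (h * g 1 0), a - 1, N * c, ?_, ?_⟩
    · push_cast
      rw [← h1]
      field_simp
      linear_combination hdet
    · push_cast
      rw [← h3]
      field_simp
      ring

lemma isBigO_jFun_smul {g : SL(2, ℝ)} (hg : RatCusp g) :
    ∃ C : ℝ, (fun z => jFun (g • z)) =O[atImInfty] fun z => Real.exp (C * z.im) := by
  obtain ⟨γ, hγ⟩ := hg.exists_upper
  refine ⟨2 * Real.pi * (toReal γ * g) 0 0 ^ 2, ?_⟩
  have := isBigO_jFun.comp_tendsto (tendsto_smul_of_upper hγ)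
  refine (this.congr_left fun z => ?_).congr_right fun z => ?_
  · rw [Function.comp_apply, mul_smul, jFun_smul]
  · rw [Function.comp_apply, im_smul_of_upper hγ, mul_assoc (2 * Real.pi)]

lemma mdifferentiable_comp_smul {f : ℍ → ℂ} (hf : MDiff f) (g : SL(2, ℝ)) :
    MDiff (fun z => f (g • z)) :=
  hf.comp (UpperHalfPlane.mdifferentiable_smul (g := (g : GL (Fin 2) ℝ)) (by simp))

lemma germ_pullback_jMero (g : SL(2, ℝ)) :
    ((fun z => jFun (g • z) : ℍ → ℂ) : FunGerm) = (pullback g jMero : Mero) :=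
  germ_pullback (coe_ofHolo _ _).symm g

lemma isMeroAtInfty_pullback_jMero {g : SL(2, ℝ)} (hg : RatCusp g) {h : ℝ} (hh : 0 < h)
    (hper : pullback (transl h) (pullback g jMero) = pullback g jMero) :
    IsMeroAtInfty h (pullback g jMero) := by
  obtain ⟨C, hC⟩ := isBigO_jFun_smul hg
  have hf := mdifferentiable_comp_smul mdifferentiable_jFun g
  have hgerm := germ_pullback_jMero g
  have hp := eq_of_germ_eq (mdifferentiable_comp_smul hf (transl h)).continuous hf.continuous
    ((germ_pullback hgerm (transl h)).trans ((congrArg _ hper).trans hgerm.symm))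
  obtain ⟨G, hG, hfG⟩ := exists_meromorphicAt_of_periodic hf hh
    (fun z => by simpa only [transl_smul] using congrFun hp z) hC
  exact ⟨_, hgerm, G, hG, Eventually.of_forall hfG⟩

/-- If `j ∘ s` is invariant under `Γ₀(N)` and `s` preserves `ℙ¹(ℚ)`, then `j ∘ s` belongs to
`ℂ(X₀(N))`: meromorphy at the cusps of `Γ₀(N)` follows from that of `j` at `∞`. -/
lemma pullback_jMero_mem {N : ℕ} {s : SL(2, ℝ)}
    (hinv : ∀ γ ∈ Gamma0R N, pullback γ (pullback s jMero) = pullback s jMero)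
    (hs : ∀ g, RatCusp g → RatCusp (s * g)) : pullback s jMero ∈ complexFunctionField N := by
  refine ⟨hinv, fun g h hh hg => ?_⟩
  rw [pullback_pullback]
  refine isMeroAtInfty_pullback_jMero (hs g (ratCusp_of_conj_mem hh.ne' hg)) hh ?_
  have h1 := congrArg (pullback g) (hinv _ hg)
  simp only [pullback_pullback] at h1 ⊢
  rw [← h1]
  congr 2
  group

/-- The matrix `diag(√n, 1/√n)`, inducing `z ↦ nz`. -/
def scaling (n : ℕ) [NeZero n] : SL(2, ℝ) :=
  ⟨!![√n, 0; 0, (√n)⁻¹], by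
    have : √(n : ℝ) ≠ 0 := by simp [NeZero.ne n]
    rw [Matrix.det_fin_two_of]
    field_simp
    simp⟩

lemma sqrt_natCast_ne_zero (n : ℕ) [NeZero n] : √(n : ℝ) ≠ 0 := by simp [NeZero.ne n]

lemma scaling_entries (n : ℕ) [NeZero n] : scaling n 0 0 = √n ∧ scaling n 0 1 = 0 ∧
    scaling n 1 0 = 0 ∧ scaling n 1 1 = (√n)⁻¹ := by
  simp [scaling]

lemma coe_scaling_smul (n : ℕ) [NeZero n] (z : ℍ) : ((scaling n • z : ℍ) : ℂ) = n * z := by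
  rw [coe_smul_of_upper (by simp [scaling])]
  simp [scaling]

lemma RatCusp.scaling_mul {g : SL(2, ℝ)} (hg : RatCusp g) (n : ℕ) [NeZero n] :
    RatCusp (scaling n * g) := by
  obtain ⟨t, a, b, ha, hb⟩ := hg
  have h0 := sqrt_natCast_ne_zero n
  have h1 : √(n : ℝ) * √(n : ℝ) = n := Real.mul_self_sqrt (Nat.cast_nonneg n)
  refine ⟨t / √n, n * a, b, ?_, ?_⟩
  · rw [mul_entry, ha]
    simp only [scaling]
    simp
    field_simp
    linear_combination (t * a) * h1
  · rw [mul_entry, hb]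
    simp only [scaling]
    simp
    field_simp

lemma ratCusp_toReal (γ : SL(2, ℤ)) : RatCusp (toReal γ) :=
  ⟨1, γ 0 0, γ 1 0, by simp, by simp⟩

lemma exists_scaling_mul {N : ℕ} [NeZero N] {γ : SL(2, ℝ)} (hγ : γ ∈ Gamma0R N) :
    ∃ γ' : SL(2, ℤ), scaling N * γ = toReal γ' * scaling N := by
  obtain ⟨a, b, c, e, h1, h2, h3, h4⟩ := mem_Gamma0R_iff.1 hγ
  have hdet := det_eq_one γ
  rw [h1, h2, h3, h4] at hdet
  have hs := sqrt_natCast_ne_zero N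
  have hs2 : √(N : ℝ) * √(N : ℝ) = N := Real.mul_self_sqrt (Nat.cast_nonneg N)
  obtain ⟨γ', g1, g2, g3, g4⟩ := exists_toReal_entries (a := a) (b := N * b) (c := c) (d := e) (by
    have : a * e - b * (N * c) = 1 := by exact_mod_cast hdet
    linear_combination this)
  obtain ⟨s1, s2, s3, s4⟩ := scaling_entries N
  refine ⟨γ', sl2_ext ?_ ?_ ?_ ?_⟩
  all_goals
    rw [mul_entry, mul_entry]
    simp only [h1, h2, h3, h4, s1, s2, s3, s4, g1, g2, g3, g4]
    push_cast
    field_simp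
  · ring
  · linear_combination (b : ℝ) * hs2
  · linear_combination -(c : ℝ) * hs2
  · ring

/-- The function `j(z)` on `X₀(N)`. -/
def jX (N : ℕ) : complexFunctionField N :=
  ⟨pullback 1 jMero, pullback_jMero_mem (fun γ hγ => by
    obtain ⟨γ', -, rfl⟩ := hγ
    rw [pullback_one]
    exact pullback_jMero γ') fun g hg => by rwa [one_mul]⟩

lemma coe_jX (N : ℕ) : (jX N : Mero) = jMero := pullback_one jMero

/-- The function `j(Nz)` on `X₀(N)`. -/
def jNX (N : ℕ) [NeZero N] : complexFunctionField N :=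
  ⟨pullback (scaling N) jMero, pullback_jMero_mem (fun γ hγ => by
    obtain ⟨γ', h⟩ := exists_scaling_mul hγ
    rw [pullback_pullback, h, ← pullback_pullback, pullback_jMero]) fun g hg => hg.scaling_mul N⟩

lemma coe_jNX (N : ℕ) [NeZero N] : (jNX N : Mero) = pullback (scaling N) jMero := rfl

/-- Comparing growth at `i∞`, an element of `SL₂(ℤ)` fixing `j(Nz)` lies in `Γ₀(N)`. -/
lemma mem_Gamma0R_of_pullback_eq {N : ℕ} [NeZero N] {γ : SL(2, ℤ)}
    (h : pullback (toReal γ) (pullback (scaling N) jMero) = pullback (scaling N) jMero) :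
    toReal γ ∈ Gamma0R N := by
  obtain ⟨γ', hγ'⟩ := ((ratCusp_toReal γ).scaling_mul N).exists_upper
  set U := toReal γ' * (scaling N * toReal γ) with hU
  have h1 : pullback U jMero = pullback (scaling N) jMero := by
    rw [hU, ← pullback_pullback, pullback_jMero, ← pullback_pullback, h]
  have h2 : (fun z : ℍ => jFun (U • z)) = fun z => jFun (scaling N • z) :=
    eq_of_germ_eq (mdifferentiable_comp_smul mdifferentiable_jFun _).continuous
      (mdifferentiable_comp_smul mdifferentiable_jFun _).continuous
      ((germ_pullback_jMero _).trans ((congrArg _ h1).trans (germ_pullback_jMero _).symm))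
  have hsN : (scaling N) 1 0 = 0 := by simp [scaling]
  have hsN' : (scaling N) 0 0 ^ 2 = N := by simp [scaling]
  have hs := sqrt_natCast_ne_zero N
  have hs2 : √(N : ℝ) * √(N : ℝ) = N := Real.mul_self_sqrt (Nat.cast_nonneg N)
  -- the ratio of the leading terms has modulus `exp (2π (α² - N) Im z)`, where `U = (α, β; 0, 1/α)`
  have hα : U 0 0 ^ 2 = N := by
    have t1 := (tendsto_jFun_mul_qParam.comp (tendsto_smul_of_upper hγ')).norm
    have t2 := (tendsto_jFun_mul_qParam.comp (tendsto_smul_of_upper hsN)).norm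
    have t3 := t1.div t2 (by simp)
    rw [div_self (by simp)] at t3
    have t4 : Tendsto (fun z : ℍ => Real.exp (2 * Real.pi * (N - U 0 0 ^ 2) * z.im))
        atImInfty (𝓝 1) := by
      rw [norm_one] at t2
      have hne : ∀ᶠ z : ℍ in atImInfty, jFun (scaling N • z) ≠ 0 := by
        filter_upwards [t2.eventually_ne one_ne_zero] with z hz h0
        exact hz (by simp [h0])
      refine t3.congr' ?_
      filter_upwards [hne] with z hz
      have hz' : ‖jFun (scaling N • z)‖ ≠ 0 := norm_ne_zero_iff.2 hz
      have e : jFun (U • z) = jFun (scaling N • z) := congrFun h2 z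
      simp only [Pi.div_apply, Function.comp_apply, norm_mul, Function.Periodic.norm_qParam]
      change ‖jFun (U • z)‖ * _ / (‖jFun (scaling N • z)‖ * _) = _
      rw [e, mul_div_mul_left _ _ hz', ← Real.exp_sub, coe_im, coe_im, im_smul_of_upper hγ',
        im_smul_of_upper hsN, hsN']
      congr 1
      ring
    have t5 := (Real.continuousAt_log one_ne_zero).tendsto.comp t4
    have t5' : Tendsto (fun z : ℍ => 2 * Real.pi * (N - U 0 0 ^ 2) * z.im) atImInfty (𝓝 0) := by
      simpa [Function.comp_def] using t5
    have t6 : Tendsto (fun z : ℍ => z.im) atImInfty atTop := tendsto_comap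
    by_contra hne
    have hc : 2 * Real.pi * (N - U 0 0 ^ 2) ≠ 0 :=
      mul_ne_zero (by positivity) (sub_ne_zero.2 (Ne.symm hne))
    have : NeBot (atImInfty) := inferInstance
    have t7 : Tendsto (fun z : ℍ => z.im) atImInfty (𝓝 0) := by
      have := t5'.const_mul (2 * Real.pi * (N - U 0 0 ^ 2))⁻¹
      simpa only [← mul_assoc, inv_mul_cancel₀ hc, one_mul, mul_zero] using this
    exact not_tendsto_nhds_of_tendsto_atTop t6 0 t7
  have hγ : toReal γ = (scaling N)⁻¹ * ((toReal γ')⁻¹ * U) := by rw [hU]; group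
  -- `α = ±√N`
  obtain ⟨ε, hε⟩ : ∃ ε : ℤ, U 0 0 = ε * √N := by
    have h3 : U 0 0 ^ 2 = √(N : ℝ) ^ 2 := by rw [hα, sq, hs2]
    rcases sq_eq_sq_iff_eq_or_eq_neg.1 h3 with h4 | h4
    · exact ⟨1, by simp [h4]⟩
    · exact ⟨-1, by simp [h4]⟩
  refine mem_Gamma0R_iff.2 ⟨γ 0 0, γ 0 1, -ε * γ' 1 0, γ 1 1, by simp, by simp, ?_, by simp⟩
  obtain ⟨s1, s2, s3, s4⟩ := scaling_entries N
  rw [hγ, mul_entry, mul_entry (toReal γ')⁻¹, mul_entry (toReal γ')⁻¹, hγ', hε,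
    inv_entry_one_zero, inv_entry_one_one, inv_entry_one_zero, s1, s3, toReal_apply]
  push_cast
  linear_combination (-(ε : ℝ) * γ' 1 0) * hs2

/-! ### Meromorphic functions of level one -/

/-- The meromorphic functions on `ℍ` of at most exponential growth at `i∞`, uniformly in the real
part. In contrast to `IsMeroAtInfty`, no period is prescribed. -/
def tempered : Subalgebra ℂ Mero where
  carrier := {φ | ∃ f : ℍ → ℂ, (f : FunGerm) = φ ∧
    ∃ C : ℝ, f =O[atImInfty] fun z => Real.exp (C * z.im)}
  mul_mem' := by
    rintro φ ψ ⟨f, hf, C, hC⟩ ⟨g, hg, D, hD⟩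
    refine ⟨f * g, germ_mul hf hg, C + D, (hC.mul hD).congr_right fun z => ?_⟩
    rw [← Real.exp_add, add_mul]
  add_mem' := by
    have aux : ∀ {f : ℍ → ℂ} {C D : ℝ}, C ≤ D → (f =O[atImInfty] fun z => Real.exp (C * z.im)) →
        f =O[atImInfty] fun z => Real.exp (D * z.im) := by
      intro f C D hCD h
      refine h.trans (Asymptotics.IsBigO.of_bound 1 (Eventually.of_forall fun z => ?_))
      rw [Real.norm_of_nonneg (Real.exp_pos _).le, Real.norm_of_nonneg (Real.exp_pos _).le, one_mul,
        Real.exp_le_exp]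
      exact mul_le_mul_of_nonneg_right hCD z.im_pos.le
    rintro φ ψ ⟨f, hf, C, hC⟩ ⟨g, hg, D, hD⟩
    exact ⟨f + g, germ_add hf hg, max C D,
      (aux (le_max_left _ _) hC).add (aux (le_max_right _ _) hD)⟩
  algebraMap_mem' c := by
    refine ⟨fun _ => c, germ_algebraMap c, 0, ?_⟩
    simpa using Asymptotics.isBigO_const_const c (one_ne_zero : (1 : ℝ) ≠ 0) atImInfty

lemma IsMeroAtInfty.mem_tempered {φ : Mero} {h : ℝ} (hh : 0 < h) (hφ : IsMeroAtInfty h φ) :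
    φ ∈ tempered := by
  obtain ⟨f, hf, G, ⟨n, hn⟩, hG⟩ := hφ
  refine ⟨f, hf, 2 * Real.pi / h * n, ?_⟩
  have h1 := (hn.continuousAt.tendsto.mono_left nhdsWithin_le_nhds).isBigO_one ℝ
    |>.comp_tendsto (tendsto_qParam_atImInfty hh)
  have h2 := h1.mul (Asymptotics.isBigO_refl (fun z : ℍ => (qFun h z ^ n)⁻¹) atImInfty).norm_right
  refine (h2.congr' ?_ (Eventually.of_forall fun z => ?_)).trans
    (Asymptotics.isBigO_refl (fun z : ℍ => Real.exp (2 * Real.pi / h * n * z.im)) _)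
  · filter_upwards [hG] with z hz
    have := pow_ne_zero n (qFun_ne_zero h z)
    rw [hz]
    simp only [Function.comp_apply, sub_zero, smul_eq_mul]
    change qFun h z ^ n * G (qFun h z) * (qFun h z ^ n)⁻¹ = G (qFun h z)
    field_simp
  · simp only [Function.comp_apply, one_mul, norm_inv, norm_pow, norm_qFun]
    rw [← Real.exp_nat_mul, ← Real.exp_neg]
    congr 1
    ring

/-- `φ` has no pole at `z`: some representative is bounded in a punctured neighbourhood of `z`. -/
def RegAt (φ : Mero) (z : ℍ) : Prop :=
  ∃ f : ℍ → ℂ, (f : FunGerm) = φ ∧ f =O[𝓝[≠] z] (1 : ℍ → ℝ)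

lemma RegAt.mul {φ ψ : Mero} {z : ℍ} (h : RegAt φ z) (h' : RegAt ψ z) : RegAt (φ * ψ) z := by
  obtain ⟨f, hf, hf1⟩ := h
  obtain ⟨g, hg, hg1⟩ := h'
  exact ⟨f * g, germ_mul hf hg, (hf1.mul hg1).congr_right fun z => by simp⟩

lemma tendsto_smul_nhdsNE (g : SL(2, ℝ)) (z : ℍ) :
    Tendsto (fun z : ℍ => g • z) (𝓝[≠] z) (𝓝[≠] (g • z)) :=
  tendsto_nhdsWithin_of_tendsto_nhds_of_eventually_within _
    (((continuous_const_smul g).tendsto z).mono_left nhdsWithin_le_nhds)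
    (by
      filter_upwards [self_mem_nhdsWithin] with w hw
      exact fun h => hw (MulAction.injective g h))

lemma RegAt.pullback {φ : Mero} {g : SL(2, ℝ)} {z : ℍ} (h : RegAt φ (g • z)) :
    RegAt (pullback g φ) z := by
  obtain ⟨f, hf, hf1⟩ := h
  exact ⟨_, germ_pullback hf g, hf1.comp_tendsto (tendsto_smul_nhdsNE g z)⟩

lemma map_coe_nhdsNE (z : ℍ) : map UpperHalfPlane.coe (𝓝[≠] z) = 𝓝[≠] (z : ℂ) := by
  have : UpperHalfPlane.coe ⁻¹' {(z : ℂ)}ᶜ = {z}ᶜ := by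
    ext w; simp
  rw [← this]
  exact isOpenEmbedding_coe.map_nhdsWithin_preimage_eq _ _

lemma eventually_regAt (φ : Mero) (z : ℍ) : ∀ᶠ w in 𝓝[≠] z, RegAt φ w := by
  obtain ⟨f, hf, hm⟩ := φ.2
  have h1 := (hm z).eventually_analyticAt
  rw [← map_coe_nhdsNE, eventually_map] at h1
  filter_upwards [h1] with w hw
  refine ⟨f, hf, ?_⟩
  have h2 : Tendsto (fun v : ℍ => (f ∘ ofComplex) v) (𝓝[≠] w) (𝓝 ((f ∘ ofComplex) w)) :=
    (hw.continuousAt.tendsto.comp (continuous_coe.tendsto w)).mono_left nhdsWithin_le_nhds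
  simp only [Function.comp_apply, ofComplex_apply] at h2
  exact h2.isBigO_one ℝ

lemma exists_regAt_of_tempered {φ : Mero} (h : φ ∈ tempered) :
    ∃ A : ℝ, ∀ z : ℍ, A < z.im → RegAt φ z := by
  obtain ⟨f, hf, C, hC⟩ := h
  obtain ⟨c, hc⟩ := hC.bound
  obtain ⟨A, hA⟩ := (atImInfty_mem _).1 hc
  refine ⟨A, fun z hz => ⟨f, hf, ?_⟩⟩
  have h1 : f =O[𝓝[≠] z] fun z => Real.exp (C * z.im) := by
    refine Asymptotics.IsBigO.of_bound c ?_
    filter_upwards [nhdsWithin_le_nhds ((UpperHalfPlane.continuous_im.tendsto z).eventually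
      (lt_mem_nhds hz))] with w hw
    exact hA w hw.le
  refine h1.trans (Tendsto.isBigO_one ℝ (c := Real.exp (C * z.im)) ?_)
  exact ((Real.continuous_exp.comp (continuous_const.mul UpperHalfPlane.continuous_im)).tendsto
    z).mono_left nhdsWithin_le_nhds

/-- A meromorphic function without poles is holomorphic. -/
lemma exists_holo_of_regAt {φ : Mero} (h : ∀ z, RegAt φ z) :
    ∃ f : ℍ → ℂ, ∃ hf : MDiff f, φ = ofHolo f hf := by
  obtain ⟨f, hf, hm⟩ := φ.2
  have hU : MeromorphicOn (f ∘ ofComplex) upperHalfPlaneSet := fun x hx => hm ⟨x, hx⟩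
  -- the normal form of `f` is analytic wherever the order of `f` is nonnegative
  set H := toMeromorphicNFOn (f ∘ ofComplex) upperHalfPlaneSet with hH
  have hord : ∀ z : ℍ, 0 ≤ meromorphicOrderAt (f ∘ ofComplex) (z : ℂ) := by
    intro z
    by_contra hlt
    have h1 := (tendsto_cobounded_iff_meromorphicOrderAt_neg (hm z)).2 (not_le.1 hlt)
    rw [← map_coe_nhdsNE, tendsto_map'_iff] at h1
    have h1' := tendsto_norm_cobounded_atTop.comp h1
    obtain ⟨g, hg, hb⟩ := h z
    have h2 : ∀ᶠ w in 𝓝[≠] z, f w = g w :=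
      eventually_nhdsNE_of_codiscrete (Germ.coe_eq.1 (hf.trans hg.symm)) z
    obtain ⟨c, hc⟩ := hb.bound
    obtain ⟨w, hw1, hw2, hw3⟩ := ((h1'.eventually_gt_atTop c).and (h2.and hc)).exists
    simp only [Function.comp_apply, ofComplex_apply] at hw1
    rw [hw2] at hw1
    simp only [Pi.one_apply, norm_one, mul_one] at hw3
    exact absurd hw3 (not_le.2 hw1)
  have han : ∀ z : ℍ, AnalyticAt ℂ H z := fun z => by
    have hNF : MeromorphicNFAt H z := meromorphicNFOn_toMeromorphicNFOn (f ∘ ofComplex) _ z.2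
    rw [← hNF.meromorphicOrderAt_nonneg_iff_analyticAt,
      meromorphicOrderAt_toMeromorphicNFOn hU z.2]
    exact hord z
  have hmd : MDiff (fun z : ℍ => H z) := by
    rw [UpperHalfPlane.mdifferentiable_iff]
    refine DifferentiableOn.congr (f := H) (fun z hz => ?_) fun z hz => ?_
    · exact (han ⟨z, hz⟩).differentiableAt.differentiableWithinAt
    · simp [ofComplex_apply_of_im_pos hz]
  refine ⟨_, hmd, Subtype.ext (hf.symm.trans (Germ.coe_eq.2 ?_))⟩
  have : ∀ z : ℍ, ∀ᶠ w in 𝓝[≠] (z : ℂ), (f ∘ ofComplex) w = H w := fun z =>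
    (hU.toMeromorphicNFOn_eq_self_on_nhdsNE z.2).symm
  filter_upwards [eventually_codiscrete this] with z hz
  simpa using hz

lemma germ_jMero_sub_pow (c : ℂ) (n : ℕ) :
    ((fun z => (jFun z - c) ^ n : ℍ → ℂ) : FunGerm) =
      ((jMero - algebraMap ℂ Mero c) ^ n : Mero) := by
  have h : ((fun z => jFun z - c : ℍ → ℂ) : FunGerm) = (jMero - algebraMap ℂ Mero c : Mero) := by
    change (((jFun - fun _ => c : ℍ → ℂ)) : FunGerm) =
      (jMero : FunGerm) - (algebraMap ℂ Mero c : Mero)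
    rw [← germ_algebraMap]
    rfl
  rw [SubmonoidClass.coe_pow, ← h]
  rfl

/-- A pole at `p` is removed by a power of `j - j(p)`. -/
lemma exists_regAt_jMero_sub_pow_mul (φ : Mero) (p : ℍ) :
    ∃ n : ℕ, RegAt ((jMero - algebraMap ℂ Mero (jFun p)) ^ n * φ) p := by
  obtain ⟨f, hf, hm⟩ := φ.2
  obtain ⟨n, hn⟩ := hm p
  refine ⟨n, _, germ_mul (germ_jMero_sub_pow (jFun p) n) hf, ?_⟩
  have hj : DifferentiableAt ℂ (jFun ∘ ofComplex) (p : ℂ) :=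
    (UpperHalfPlane.mdifferentiable_iff.1 mdifferentiable_jFun).differentiableAt
      (isOpen_upperHalfPlaneSet.mem_nhds p.2)
  have h1 := (hj.isBigO_sub.pow n).mul
    (Asymptotics.isBigO_refl (f ∘ ofComplex) (𝓝 (p : ℂ)))
  have h2 : (fun w : ℂ => (w - p) ^ n * (f ∘ ofComplex) w) =O[𝓝 (p : ℂ)] (1 : ℂ → ℝ) :=
    hn.continuousAt.tendsto.isBigO_one ℝ
  have h3 := (h1.trans h2).comp_tendsto
    ((continuous_coe.tendsto p).mono_left (nhdsWithin_le_nhds (s := {p}ᶜ)))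
  refine h3.congr_left fun z => ?_
  simp

/-- Holomorphic functions of level one and weight zero with a pole of order at most `n` at `∞` are
polynomials in `j`; the leading coefficient is removed by subtracting a multiple of `jⁿ`. -/
lemma exists_eq_polynomial_jFun (n : ℕ) : ∀ f : ℍ → ℂ, MDiff f →
    (∀ (γ : SL(2, ℤ)) (z : ℍ), f (toReal γ • z) = f z) →
    (f =O[atImInfty] fun z => Real.exp (2 * Real.pi * n * z.im)) →
    ∃ P : Polynomial ℂ, ∀ z, f z = P.eval (jFun z) := by
  induction n with
  | zero =>
    intro f hf hinv hgr
    have hslash : ∀ γ : SL(2, ℤ), f ∣[(0 : ℤ)] γ = f := fun γ => by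
      ext z
      rw [ModularForm.SL_slash_apply, neg_zero, zpow_zero, mul_one]
      exact hinv γ z
    have hb : IsBoundedAtImInfty f := by
      rw [IsBoundedAtImInfty, BoundedAtFilter]
      refine hgr.congr_right fun z => ?_
      simp
    -- `f` is a modular form of weight zero and level one, hence constant
    let F : ModularForm 𝒮ℒ 0 :=
      { toFun := f
        slash_action_eq' := by
          rintro _ ⟨γ, rfl⟩
          exact hslash γ
        holo' := hf
        bdd_at_cusps' := by
          intro c hc
          rw [OnePoint.isBoundedAt_iff_forall_SL2Z hc]
          intro γ _
          rw [hslash γ]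
          exact hb }
    obtain ⟨c, hc⟩ := ModularFormClass.levelOne_weight_zero_const F
    exact ⟨Polynomial.C c, fun z => (congrFun hc z : f z = c).trans (by simp)⟩
  | succ n ih =>
    intro f hf hinv hgr
    have hT : ∀ {g : ℍ → ℂ}, (∀ (γ : SL(2, ℤ)) (z : ℍ), g (toReal γ • z) = g z) →
        ∀ z : ℍ, g ((1 : ℝ) +ᵥ z) = g z := fun {g} hg z => by
      rw [← modular_T_smul]
      exact hg ModularGroup.T z
    -- both `q ^ (n + 1) f` and `q ^ (n + 1) j ^ (n + 1)` are power series in `q`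
    have key : ∀ g : ℍ → ℂ, MDiff g → (∀ (γ : SL(2, ℤ)) (z : ℍ), g (toReal γ • z) = g z) →
        (g =O[atImInfty] fun z => Real.exp (2 * Real.pi * (n + 1 : ℕ) * z.im)) →
        (fun z => g z * qFun 1 z ^ (n + 1) - valueAtInfty (g * qFun 1 ^ (n + 1)))
          =O[atImInfty] fun z : ℍ => Real.exp (-2 * Real.pi * z.im / (1 : ℝ)) := by
      intro g hg hginv hggr
      refine UpperHalfPlane.exp_decay_sub_atImInfty (f := g * qFun 1 ^ (n + 1)) one_pos
        (periodic_comp_ofComplex fun z => ?_) (hg.mul ((mdifferentiable_qFun 1).pow _)) ?_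
      · simp only [Pi.mul_apply, Pi.pow_apply, qFun_vadd one_ne_zero, hT hginv]
      · rw [IsBoundedAtImInfty, BoundedAtFilter]
        refine ((hggr.mul (Asymptotics.isBigO_refl
          (fun z => qFun 1 z ^ (n + 1)) _).norm_right)).congr_right fun z => ?_
        rw [norm_pow, norm_qFun, ← Real.exp_nat_mul, ← Real.exp_add, Pi.one_apply,
          Real.exp_eq_one_iff]
        ring
    have hjgr : (fun z => jFun z ^ (n + 1)) =O[atImInfty]
        fun z => Real.exp (2 * Real.pi * (n + 1 : ℕ) * z.im) := by
      refine (isBigO_jFun.pow (n + 1)).congr_right fun z => ?_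
      rw [← Real.exp_nat_mul]
      congr 1
      ring
    have hjinv : ∀ (γ : SL(2, ℤ)) (z : ℍ), jFun (toReal γ • z) ^ (n + 1) = jFun z ^ (n + 1) :=
      fun γ z => by rw [jFun_smul]
    have k1 := key f hf hinv hgr
    have k2 := key _ (mdifferentiable_jFun.pow (n + 1)) hjinv hjgr
    have hv : valueAtInfty ((fun z => jFun z ^ (n + 1)) * qFun 1 ^ (n + 1)) = 1 := by
      have := tendsto_jFun_mul_qParam.pow (n + 1)
      rw [one_pow] at this
      refine Tendsto.limUnder_eq (this.congr fun z => ?_)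
      rw [mul_pow]
      rfl
    set c := valueAtInfty (f * qFun 1 ^ (n + 1))
    obtain ⟨P, hP⟩ := ih (f - fun z => c * jFun z ^ (n + 1))
      (hf.sub (mdifferentiable_const.mul (mdifferentiable_jFun.pow (n + 1))))
      (fun γ z => by simp only [Pi.sub_apply, hinv, jFun_smul]) (by
        have k3 := (k1.sub (k2.const_mul_left c)).mul
          (Asymptotics.isBigO_refl (fun z : ℍ => (qFun 1 z ^ (n + 1))⁻¹) atImInfty).norm_right
        refine (k3.congr_left fun z => ?_).congr_right fun z => ?_
        · have h0 := pow_ne_zero (n + 1) (qFun_ne_zero 1 z)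
          have hv' : valueAtInfty (jFun ^ (n + 1) * qFun 1 ^ (n + 1)) = 1 := hv
          simp only [Pi.sub_apply, Pi.pow_apply, hv']
          field_simp
          ring
        · rw [norm_inv, norm_pow, norm_qFun, ← Real.exp_nat_mul, ← Real.exp_neg, ← Real.exp_add]
          congr 1
          push_cast
          ring)
    refine ⟨P + Polynomial.C c * Polynomial.X ^ (n + 1), fun z => ?_⟩
    have := hP z
    rw [Pi.sub_apply, sub_eq_iff_eq_add] at this
    simp [this]

lemma germ_aeval_jMero (P : Polynomial ℂ) :
    ((fun z => P.eval (jFun z) : ℍ → ℂ) : FunGerm) = (Polynomial.aeval jMero P : Mero) := by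
  induction P using Polynomial.induction_on' with
  | add p q hp hq =>
    rw [map_add, ← germ_add hp hq]
    exact congrArg _ (funext fun z => Polynomial.eval_add)
  | monomial n a =>
    have h := germ_mul (germ_algebraMap a) (germ_jMero_sub_pow 0 n)
    rw [map_zero, sub_zero] at h
    rw [Polynomial.aeval_monomial, ← h]
    refine congrArg _ (funext fun z => ?_)
    simp

/-- A holomorphic tempered function of level one is a polynomial in `j`. -/
lemma ofHolo_mem_adjoin {f : ℍ → ℂ} (hf : MDiff f)
    (hinv : ∀ γ : SL(2, ℤ), pullback (toReal γ) (ofHolo f hf) = ofHolo f hf)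
    (ht : ofHolo f hf ∈ tempered) : ofHolo f hf ∈ Algebra.adjoin ℂ {jMero} := by
  obtain ⟨g, hg, C, hC⟩ := ht
  obtain ⟨c, hc⟩ := hC.bound
  obtain ⟨A, hA⟩ := (atImInfty_mem _).1 hc
  obtain ⟨n, hn⟩ := exists_nat_ge (C / (2 * Real.pi))
  have hgr : f =O[atImInfty] fun z => Real.exp (2 * Real.pi * n * z.im) := by
    -- the bound holds for `g`, which agrees with `f` off a discrete set, and extends by continuity
    have h1 : f =O[atImInfty] fun z => Real.exp (C * z.im) := by
      refine Asymptotics.IsBigO.of_bound c ?_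
      filter_upwards [(atImInfty_mem {z : ℍ | A < z.im}).2 ⟨A + 1, fun z hz => by
        have : A < z.im := by linarith
        exact this⟩] with z hz
      have t1 : Tendsto (fun w => ‖f w‖) (𝓝[≠] z) (𝓝 ‖f z‖) :=
        ((hf.continuous.norm).tendsto z).mono_left nhdsWithin_le_nhds
      have t2 : Tendsto (fun w : ℍ => c * ‖Real.exp (C * w.im)‖) (𝓝[≠] z)
          (𝓝 (c * ‖Real.exp (C * z.im)‖)) :=
        ((continuous_const.mul (Real.continuous_exp.comp
          (continuous_const.mul UpperHalfPlane.continuous_im)).norm).tendsto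
          z).mono_left nhdsWithin_le_nhds
      refine le_of_tendsto_of_tendsto t1 t2 ?_
      filter_upwards [eventually_nhdsNE_of_codiscrete (Germ.coe_eq.1 hg) z, nhdsWithin_le_nhds
        ((UpperHalfPlane.continuous_im.tendsto z).eventually (lt_mem_nhds hz))] with w h1 h2
      rw [← h1]
      exact hA w h2.le
    refine h1.trans (Asymptotics.IsBigO.of_bound 1 (Eventually.of_forall fun z => ?_))
    rw [Real.norm_of_nonneg (Real.exp_pos _).le, Real.norm_of_nonneg (Real.exp_pos _).le, one_mul,
      Real.exp_le_exp]
    rw [div_le_iff₀ (by positivity)] at hn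
    exact mul_le_mul_of_nonneg_right (by linarith) z.im_pos.le
  have hinv' : ∀ (γ : SL(2, ℤ)) (z : ℍ), f (toReal γ • z) = f z := fun γ z => by
    have h1 := germ_pullback (coe_ofHolo f hf).symm (toReal γ)
    exact congrFun (eq_of_germ_eq (mdifferentiable_comp_smul hf _).continuous hf.continuous
      (h1.trans (congrArg _ (hinv γ)))) z
  obtain ⟨P, hP⟩ := exists_eq_polynomial_jFun n f hf hinv' hgr
  have : ofHolo f hf = Polynomial.aeval jMero P :=
    Subtype.ext ((congrArg Germ.ofFun (funext hP)).trans (germ_aeval_jMero P))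
  rw [this]
  exact Polynomial.aeval_mem_adjoin_singleton ℂ _

lemma jMero_mem_tempered : jMero ∈ tempered := ⟨jFun, rfl, _, isBigO_jFun⟩

lemma jMero_sub_ne_zero (c : ℂ) : jMero - algebraMap ℂ Mero c ≠ 0 := by
  intro h
  rw [sub_eq_zero] at h
  have h1 : jFun = fun _ => c := eq_of_germ_eq mdifferentiable_jFun.continuous continuous_const
    ((congrArg Subtype.val h).trans (germ_algebraMap c).symm)
  have h2 := tendsto_jFun_mul_qParam
  rw [h1] at h2
  have h3 := ((tendsto_qParam_atImInfty one_pos).mono_right nhdsWithin_le_nhds).const_mul c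
  rw [mul_zero] at h3
  exact zero_ne_one (tendsto_nhds_unique h3 h2)

lemma regAt_jMero_sub_pow (c : ℂ) (n : ℕ) (z : ℍ) :
    RegAt ((jMero - algebraMap ℂ Mero c) ^ n) z := by
  refine ⟨_, germ_jMero_sub_pow c n, Tendsto.isBigO_one ℝ (c := (jFun z - c) ^ n) ?_⟩
  exact (((mdifferentiable_jFun.continuous.sub continuous_const).pow n).tendsto z).mono_left
    nhdsWithin_le_nhds

lemma regAt_prod {ι : Type*} (s : Finset ι) (φ : ι → Mero) (z : ℍ) (h : ∀ i ∈ s, RegAt (φ i) z) :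
    RegAt (∏ i ∈ s, φ i) z :=
  Finset.prod_induction φ (fun ψ => RegAt ψ z) (fun _ _ => RegAt.mul)
    ⟨fun _ => 1, rfl, (tendsto_const_nhds (x := (1 : ℂ))).isBigO_one ℝ⟩ h

/-- Multiplication with `∏ (j - j(p))^m`, where `p` runs over the finitely many poles in the
fundamental domain, removes all poles of a tempered function of level one. -/
lemma exists_finset_regAt {φ : Mero} (hinv : ∀ γ : SL(2, ℤ), pullback (toReal γ) φ = φ)
    (ht : φ ∈ tempered) : ∃ (t : Finset ℍ) (m : ℍ → ℕ), ∀ z,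
      RegAt ((∏ p ∈ t, (jMero - algebraMap ℂ Mero (jFun p)) ^ m p) * φ) z := by
  classical
  obtain ⟨A, hA⟩ := exists_regAt_of_tempered ht
  obtain ⟨t, -, ht'⟩ := (ModularGroup.isCompact_truncatedFundamentalDomain A).elim_nhds_subcover
    (fun z => {w | w = z ∨ RegAt φ w}) (fun z _ => by
      have := eventually_regAt φ z
      rw [eventually_nhdsWithin_iff] at this
      filter_upwards [this] with w hw
      exact or_iff_not_imp_left.2 hw)
  -- poles high up are excluded by temperedness, the others by compactness
  have hreg : ∀ z ∈ ModularGroup.fd, z ∉ t → RegAt φ z := by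
    intro z hz hzt
    rcases le_or_gt z.im A with h | h
    · obtain ⟨x, hx, hx'⟩ := Set.mem_iUnion₂.1 (ht' ⟨hz, h⟩)
      rcases hx' with rfl | h'
      · exact absurd hx hzt
      · exact h'
    · exact hA z h
  choose m hm using exists_regAt_jMero_sub_pow_mul φ
  refine ⟨t, m, ?_⟩
  have hregP : ∀ z ∈ ModularGroup.fd,
      RegAt ((∏ p ∈ t, (jMero - algebraMap ℂ Mero (jFun p)) ^ m p) * φ) z := by
    intro z hz
    by_cases hzt : z ∈ t
    · rw [← Finset.prod_erase_mul _ _ hzt, mul_assoc]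
      exact (regAt_prod _ _ _ fun p _ => regAt_jMero_sub_pow _ _ _).mul (hm z)
    · exact (regAt_prod _ _ _ fun p _ => regAt_jMero_sub_pow _ _ _).mul (hreg z hz hzt)
  intro z
  obtain ⟨γ, hγ⟩ := ModularGroup.exists_smul_mem_fd z
  have := (RegAt.pullback (g := toReal γ) (hregP _ hγ))
  rw [map_mul, map_prod, hinv] at this
  simpa only [map_pow, map_sub, AlgHom.commutes, pullback_jMero] using this

lemma prod_sub_pow_mem {E ι : Type*} [Field E] [Algebra ℂ E] (T : Subalgebra ℂ E) {x : E}
    (hx : x ∈ T) (t : Finset ι) (c : ι → ℂ) (m : ι → ℕ) :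
    ∏ p ∈ t, (x - algebraMap ℂ E (c p)) ^ m p ∈ T :=
  Subalgebra.prod_mem _ fun _ _ =>
    Subalgebra.pow_mem _ (Subalgebra.sub_mem _ hx (Subalgebra.algebraMap_mem _ _)) _

lemma mem_adjoin_of_prod_mul_mem {E ι : Type*} [Field E] [Algebra ℂ E] {x φ : E}
    (hx : ∀ c : ℂ, x - algebraMap ℂ E c ≠ 0) (t : Finset ι) (c : ι → ℂ) (m : ι → ℕ)
    (h : (∏ p ∈ t, (x - algebraMap ℂ E (c p)) ^ m p) * φ ∈ Algebra.adjoin ℂ {x}) :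
    φ ∈ IntermediateField.adjoin ℂ {x} := by
  have hP := prod_sub_pow_mem (Algebra.adjoin ℂ {x}) (Algebra.self_mem_adjoin_singleton ℂ x) t c m
  have hle : ∀ y ∈ Algebra.adjoin ℂ {x}, y ∈ IntermediateField.adjoin ℂ {x} := fun y hy =>
    IntermediateField.algebra_adjoin_le_adjoin ℂ {x} hy
  have hP0 : ∏ p ∈ t, (x - algebraMap ℂ E (c p)) ^ m p ≠ 0 :=
    Finset.prod_ne_zero_iff.2 fun p _ => pow_ne_zero _ (hx _)
  have := div_mem (hle _ h) (hle _ hP)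
  rwa [mul_div_cancel_left₀ _ hP0] at this

/-- A tempered function of level one is a rational function of `j`. -/
lemma mem_adjoin_jMero {φ : Mero} (hinv : ∀ γ : SL(2, ℤ), pullback (toReal γ) φ = φ)
    (ht : φ ∈ tempered) : φ ∈ IntermediateField.adjoin ℂ {jMero} := by
  obtain ⟨t, m, hreg⟩ := exists_finset_regAt hinv ht
  refine mem_adjoin_of_prod_mul_mem jMero_sub_ne_zero t (fun p => jFun p) m ?_
  obtain ⟨f, hf, h⟩ := exists_holo_of_regAt hreg
  have hP := prod_sub_pow_mem tempered jMero_mem_tempered t (fun p => jFun p) m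
  have hPt := Subalgebra.mul_mem tempered hP ht
  have hPinv : ∀ γ : SL(2, ℤ), pullback (toReal γ)
      ((∏ p ∈ t, (jMero - algebraMap ℂ Mero (jFun p)) ^ m p) * φ) =
      (∏ p ∈ t, (jMero - algebraMap ℂ Mero (jFun p)) ^ m p) * φ := fun γ => by
    rw [map_mul, map_prod, hinv]
    simp only [map_pow, map_sub, AlgHom.commutes, pullback_jMero]
  generalize (∏ p ∈ t, (jMero - algebraMap ℂ Mero (jFun p)) ^ m p) * φ = ψ at *
  subst h
  exact ofHolo_mem_adjoin hf hPinv hPt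

/-! ### Generation of `ℂ(X₀(N))` by `j(z)` and `j(Nz)` -/

/-- Let `a q`, `b q` be two families in a field, permuted in the same way by a family of
endomorphisms `u i`, and suppose `b q₀` differs from the other `b q`. Then `a q₀` is a rational
expression in `b q₀` over any field `F` containing the elements of `T` fixed by all `u i`.
This is Lagrange interpolation: the numerator polynomial `∑ a q ∏ (X - b q')` has invariant
coefficients, and likewise for `a = 1`. -/
lemma mem_of_lagrange {E Q ι : Type*} [Field E] [Algebra ℂ E] [Fintype Q] [DecidableEq Q]
    (u : ι → E →ₐ[ℂ] E) (π : ι → Equiv.Perm Q) (T : Subalgebra ℂ E) (F : IntermediateField ℂ E)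
    (hF : ∀ x ∈ T, (∀ i, u i x = x) → x ∈ F) {a b : Q → E} (ha : ∀ q, a q ∈ T)
    (hb : ∀ q, b q ∈ T) (hua : ∀ i q, u i (a q) = a (π i q)) (hub : ∀ i q, u i (b q) = b (π i q))
    {q₀ : Q} (hbF : b q₀ ∈ F) (hne : ∀ q ≠ q₀, b q ≠ b q₀) : a q₀ ∈ F := by
  have key : ∀ c : Q → E, (∀ q, c q ∈ T) → (∀ i q, u i (c q) = c (π i q)) →
      c q₀ * ∏ q ∈ Finset.univ.erase q₀, (b q₀ - b q) ∈ F := by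
    intro c hc huc
    let I : Polynomial E := ∑ q, Polynomial.C (c q) *
      ∏ q' ∈ Finset.univ.erase q, (Polynomial.X - Polynomial.C (b q'))
    let I' : Polynomial T := ∑ q, Polynomial.C (⟨c q, hc q⟩ : T) *
      ∏ q' ∈ Finset.univ.erase q, (Polynomial.X - Polynomial.C (⟨b q', hb q'⟩ : T))
    have hI' : I'.map (algebraMap T E) = I := by
      simp only [I, I', Polynomial.map_sum, Polynomial.map_mul, Polynomial.map_prod,
        Polynomial.map_sub, Polynomial.map_C, Polynomial.map_X]
      rfl
    have hIu : ∀ i, I.map (u i : E →+* E) = I := by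
      intro i
      simp only [I, Polynomial.map_sum, Polynomial.map_mul, Polynomial.map_prod,
        Polynomial.map_sub, Polynomial.map_C, Polynomial.map_X, RingHom.coe_coe, huc, hub]
      refine Fintype.sum_equiv (π i) _ _ fun q => ?_
      congr 1
      refine Finset.prod_equiv (π i) (fun q' => ?_) fun _ _ => rfl
      simp
    have hcoeff : ∀ n, I.coeff n ∈ F := fun n => by
      refine hF _ ?_ fun i => ?_
      · rw [← hI', Polynomial.coeff_map]
        exact (I'.coeff n).2
      · have := congrArg (fun p => p.coeff n) (hIu i)
        simpa [Polynomial.coeff_map] using this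
    have heval : I.eval (b q₀) = c q₀ * ∏ q ∈ Finset.univ.erase q₀, (b q₀ - b q) := by
      simp only [I, Polynomial.eval_finsetSum, Polynomial.eval_mul, Polynomial.eval_C,
        Polynomial.eval_prod, Polynomial.eval_sub, Polynomial.eval_X]
      refine Finset.sum_eq_single_of_mem q₀ (Finset.mem_univ _) fun q _ hq => ?_
      rw [Finset.prod_eq_zero (Finset.mem_erase.2 ⟨hq.symm, Finset.mem_univ _⟩) (sub_self _),
        mul_zero]
    rw [← heval, Polynomial.eval_eq_sum_range]
    exact sum_mem fun n _ => mul_mem (hcoeff n) (pow_mem hbF n)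
  have h1 := key a ha hua
  have h2 := key (fun _ => 1) (fun _ => one_mem T) (fun i _ => map_one _)
  rw [one_mul] at h2
  have h0 : ∏ q ∈ Finset.univ.erase q₀, (b q₀ - b q) ≠ 0 :=
    Finset.prod_ne_zero_iff.2 fun q hq => sub_ne_zero.2 (hne q (Finset.ne_of_mem_erase hq)).symm
  have := div_mem h1 h2
  rwa [mul_div_cancel_right₀ _ h0] at this

/-- The conjugates of `φ` under `SL₂(ℤ)`, indexed by the cosets of `Γ₀(N)`. The coset of `g` gives
`φ ∘ g⁻¹`; for invariant `φ` the choice of the representative does not matter, see `conj_mk`. -/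
def conj {N : ℕ} (φ : Mero) (q : SL(2, ℤ) ⧸ CongruenceSubgroup.Gamma0 N) : Mero :=
  pullback (toReal q.out⁻¹) φ

lemma toReal_mem {N : ℕ} {γ : SL(2, ℤ)} (hγ : γ ∈ CongruenceSubgroup.Gamma0 N) :
    toReal γ ∈ Gamma0R N := ⟨γ, hγ, rfl⟩

lemma of_toReal_mem {N : ℕ} {γ : SL(2, ℤ)} (hγ : toReal γ ∈ Gamma0R N) :
    γ ∈ CongruenceSubgroup.Gamma0 N := by
  obtain ⟨γ', h, h'⟩ := hγ
  rwa [← Matrix.SpecialLinearGroup.map_intCast_injective h']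

lemma conj_mk {N : ℕ} {φ : Mero} (hφ : ∀ γ ∈ Gamma0R N, pullback γ φ = φ) (g : SL(2, ℤ)) :
    conj φ (g : SL(2, ℤ) ⧸ CongruenceSubgroup.Gamma0 N) = pullback (toReal g⁻¹) φ := by
  obtain ⟨h, hh⟩ := QuotientGroup.mk_out_eq_mul (CongruenceSubgroup.Gamma0 N) g
  rw [conj, hh, mul_inv_rev, map_mul, ← pullback_pullback, hφ _ (toReal_mem (inv_mem h.2))]

lemma pullback_conj {N : ℕ} {φ : Mero} (hφ : ∀ γ ∈ Gamma0R N, pullback γ φ = φ) (g : SL(2, ℤ))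
    (q : SL(2, ℤ) ⧸ CongruenceSubgroup.Gamma0 N) :
    pullback (toReal g) (conj φ q) = conj φ (MulAction.toPerm g⁻¹ q) := by
  induction q using QuotientGroup.induction_on with | _ k
  rw [MulAction.toPerm_apply, MulAction.Quotient.smul_coe, conj_mk hφ, conj_mk hφ,
    pullback_pullback, ← map_mul]
  simp

lemma conj_mem_tempered {N : ℕ} [NeZero N] (φ : complexFunctionField N)
    (q : SL(2, ℤ) ⧸ CongruenceSubgroup.Gamma0 N) : conj (φ : Mero) q ∈ tempered := by
  have hN : (0 : ℝ) < N := by exact_mod_cast Nat.pos_of_ne_zero (NeZero.ne N)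
  refine IsMeroAtInfty.mem_tempered hN (φ.2.2 _ N hN ?_)
  -- the coset does not matter: `γ (1, N; 0, 1) γ⁻¹` belongs to `Γ₀(N)` for every `γ` in `SL₂(ℤ)`
  set γ := q.out⁻¹
  rw [mem_Gamma0R_iff]
  refine ⟨1 - N * (γ 0 0 * γ 1 0), N * (γ 0 0) ^ 2, - (γ 1 0) ^ 2, 1 + N * (γ 0 0 * γ 1 0), ?_⟩
  have hdet := det_eq_one (toReal γ)
  obtain ⟨t1, t2, t3, t4⟩ := transl_entries (N : ℝ)
  simp only [toReal_apply] at hdet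
  simp only [mul_entry, inv_entry_zero_zero, inv_entry_zero_one, inv_entry_one_zero,
    inv_entry_one_one, t1, t2, t3, t4, toReal_apply]
  push_cast
  refine ⟨?_, ?_, ?_, ?_⟩ <;> first | linear_combination hdet | ring

lemma coe_mem_adjoin {N : ℕ} [NeZero N] (φ : complexFunctionField N) :
    (φ : Mero) ∈ IntermediateField.adjoin ℂ {jMero, pullback (scaling N) jMero} := by
  classical
  have := Fintype.ofFinite (SL(2, ℤ) ⧸ CongruenceSubgroup.Gamma0 N)
  have h1 : ∀ ψ : complexFunctionField N,
      conj (ψ : Mero) ((1 : SL(2, ℤ)) : SL(2, ℤ) ⧸ CongruenceSubgroup.Gamma0 N) = ψ := fun ψ => by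
    rw [conj_mk ψ.2.1, inv_one, map_one, pullback_one]
  rw [← h1]
  refine mem_of_lagrange (fun g : SL(2, ℤ) => pullback (toReal g))
    (fun g => MulAction.toPerm g⁻¹) tempered _ ?_ (a := conj (φ : Mero))
    (b := conj (jNX N : Mero)) (conj_mem_tempered φ) (conj_mem_tempered (jNX N))
    (pullback_conj φ.2.1) (pullback_conj (jNX N).2.1) ?_ ?_
  · intro ψ ht hinv
    exact IntermediateField.adjoin.mono ℂ _ _ (by simp) (mem_adjoin_jMero hinv ht)
  · rw [h1, coe_jNX]
    exact IntermediateField.subset_adjoin _ _ (by simp)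
  · intro q hq h
    apply hq
    induction q using QuotientGroup.induction_on with | _ g
    rw [h1, conj_mk (jNX N).2.1, coe_jNX] at h
    have := of_toReal_mem (mem_Gamma0R_of_pullback_eq h)
    exact (QuotientGroup.eq.2 (by simpa using this))

/-- The field `ℂ(X₀(N))` is generated by `j(z)` and `j(Nz)`. -/
lemma mem_adjoin_jX_jNX {N : ℕ} [NeZero N] (φ : complexFunctionField N) :
    φ ∈ IntermediateField.adjoin ℂ {jX N, jNX N} := by
  have h := coe_mem_adjoin φ
  have h2 : IntermediateField.adjoin ℂ {jMero, pullback (scaling N) jMero} =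
      (IntermediateField.adjoin ℂ {jX N, jNX N}).map (complexFunctionField N).val := by
    rw [IntermediateField.adjoin_map, Set.image_pair]
    rw [← coe_jNX, ← coe_jX N]
    rfl
  rw [h2] at h
  obtain ⟨ψ, hψ, h'⟩ := h
  rwa [← Subtype.ext h']

open ModularForm (E₄ E₆ discriminant discriminant_ne_zero)

/-! ### Laurent series with coefficients in a subfield -/

/-- The map of Laurent series that applies a ring homomorphism to the coefficients. -/
def laurentMap {R S : Type*} [CommRing R] [CommRing S] (i : R →+* S) :
    LaurentSeries R →+* LaurentSeries S where
  toFun P := P.map i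
  map_one' := by
    ext n
    by_cases hn : n = 0 <;> simp [HahnSeries.coeff_one, hn]
  map_zero' := by ext n; simp
  map_mul' P Q := HahnSeries.map_mul (i : R →ₙ+* S)
  map_add' P Q := HahnSeries.map_add (i : R →+ S)

lemma exists_laurentMap_eq {R S : Type*} [Field R] [Field S] (i : R →+* S) {P : LaurentSeries S}
    (h : ∀ n, P.coeff n ∈ i.range) : ∃ P', laurentMap i P' = P := by
  choose c hc using h
  refine ⟨⟨c, P.isPWO_support.mono fun n hn h0 => hn ?_⟩, HahnSeries.ext (funext hc)⟩
  exact i.injective (by rw [hc, h0, map_zero])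

/-- The Laurent series whose coefficients lie in `K`. -/
def coeffSubfield (K : IntermediateField ℚ ℂ) : Subfield (LaurentSeries ℂ) :=
  (laurentMap (algebraMap K ℂ)).fieldRange

lemma mem_coeffSubfield {K : IntermediateField ℚ ℂ} {P : LaurentSeries ℂ} :
    P ∈ coeffSubfield K ↔ ∀ n, P.coeff n ∈ K := by
  refine ⟨?_, fun h => exists_laurentMap_eq _ fun n => ⟨⟨_, h n⟩, rfl⟩⟩
  rintro ⟨P, rfl⟩ n
  exact (P.coeff n).2

lemma coeffSubfield_mono {K L : IntermediateField ℚ ℂ} (h : K ≤ L) {P : LaurentSeries ℂ}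
    (hP : P ∈ coeffSubfield K) : P ∈ coeffSubfield L :=
  mem_coeffSubfield.2 fun n => h (mem_coeffSubfield.1 hP n)

lemma mem_rationalFunctions_iff {N : ℕ} {φ : complexFunctionField N} :
    φ ∈ rationalFunctions N ↔ qExp N φ ∈ coeffSubfield ⊥ := by
  constructor
  · rintro ⟨f, hf, P, hP⟩
    have h : HasQExp φ (laurentMap (algebraMap ℚ ℂ) P) := ⟨f, hf, hP⟩
    rw [qExp_eq h, mem_coeffSubfield]
    exact fun n => IntermediateField.mem_bot.2 ⟨P.coeff n, rfl⟩
  · intro h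
    obtain ⟨P, hP⟩ := exists_laurentMap_eq (algebraMap ℚ ℂ) fun n =>
      IntermediateField.mem_bot.1 (mem_coeffSubfield.1 h n)
    obtain ⟨f, hf, h'⟩ := hasQExp_qExp φ
    rw [← hP] at h'
    exact ⟨f, hf, P, h'⟩

/-! ### The expansion of `j` -/

lemma hasQExp_of_modularForm {F : Type*} [FunLike F ℍ ℂ] {k : ℤ} [ModularFormClass F 𝒮ℒ k]
    (f : F) : HasQExp (ofHolo f (ModularFormClass.holo f))
      (HahnSeries.ofPowerSeries ℤ ℂ (qExpansion 1 f)) := by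
  refine ⟨f, rfl, Eventually.of_forall fun z => ?_⟩
  have h := ModularForm.hasSum_qExpansion f one_pos one_mem_strictPeriods_SL z
  have hinj : Function.Injective (fun k : ℕ => (k : ℤ)) := Nat.cast_injective
  refine (hinj.hasSum_iff (fun m hm => ?_)).1 ?_
  · rw [HahnSeries.ofPowerSeries_apply, HahnSeries.embDomain_of_notMem_range, zero_mul]
    rintro ⟨k, hk⟩
    exact hm ⟨k, hk⟩
  · refine h.congr_fun fun n => ?_
    simp [HahnSeries.ofPowerSeries_apply_coeff]

lemma ofPowerSeries_mem_coeffSubfield {K : IntermediateField ℚ ℂ} {P : PowerSeries ℂ}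
    (h : ∀ n, P.coeff n ∈ K) : HahnSeries.ofPowerSeries ℤ ℂ P ∈ coeffSubfield K := by
  rw [mem_coeffSubfield]
  intro n
  by_cases hn : n ∈ Set.range (fun k : ℕ => (k : ℤ))
  · obtain ⟨k, rfl⟩ := hn
    simpa [HahnSeries.ofPowerSeries_apply_coeff] using h k
  · rw [HahnSeries.ofPowerSeries_apply, HahnSeries.embDomain_of_notMem_range]
    · exact zero_mem K
    · rintro ⟨k, hk⟩
      exact hn ⟨k, hk⟩

lemma eisenstein_mem_coeffSubfield {k : ℕ} (hk : 3 ≤ k) (hk2 : Even k) :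
    HahnSeries.ofPowerSeries ℤ ℂ (qExpansion 1 (ModularForm.E hk)) ∈ coeffSubfield ⊥ := by
  refine ofPowerSeries_mem_coeffSubfield fun n => ?_
  rw [EisensteinSeries.E_qExpansion_coeff hk hk2]
  split_ifs
  · exact one_mem _
  · refine IntermediateField.mem_bot.2
      ⟨-(2 * k / bernoulli k) * (ArithmeticFunction.sigma (k - 1) n), ?_⟩
    simp

lemma jMero_mul_discriminant :
    jMero * ofHolo CuspForm.discriminant (ModularFormClass.holo CuspForm.discriminant) =
      ofHolo E₄ (ModularFormClass.holo E₄) * ofHolo E₄ (ModularFormClass.holo E₄) *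
        ofHolo E₄ (ModularFormClass.holo E₄) := by
  refine Subtype.ext ?_
  rw [← germ_mul rfl (coe_ofHolo _ _).symm, ← germ_mul (germ_mul (coe_ofHolo _ _).symm
    (coe_ofHolo _ _).symm) (coe_ofHolo _ _).symm]
  refine congrArg Germ.ofFun (funext fun z => ?_)
  have h := discriminant_ne_zero z
  show E₄ z ^ 3 / discriminant z * discriminant z = E₄ z * E₄ z * E₄ z
  field_simp

lemma discriminant_mul :
    algebraMap ℂ Mero 1728 *
        ofHolo CuspForm.discriminant (ModularFormClass.holo CuspForm.discriminant) =
      ofHolo E₄ (ModularFormClass.holo E₄) * ofHolo E₄ (ModularFormClass.holo E₄) *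
        ofHolo E₄ (ModularFormClass.holo E₄) + algebraMap ℂ Mero (-1) *
        (ofHolo E₆ (ModularFormClass.holo E₆) * ofHolo E₆ (ModularFormClass.holo E₆)) := by
  refine Subtype.ext ?_
  rw [← germ_mul (germ_algebraMap _) (coe_ofHolo _ _).symm, ← germ_add (germ_mul (germ_mul
    (coe_ofHolo _ _).symm (coe_ofHolo _ _).symm) (coe_ofHolo _ _).symm)
    (germ_mul (germ_algebraMap _) (germ_mul (coe_ofHolo _ _).symm (coe_ofHolo _ _).symm))]
  refine congrArg Germ.ofFun (funext fun z => ?_)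
  show 1728 * discriminant z = E₄ z * E₄ z * E₄ z + -1 * (E₆ z * E₆ z)
  rw [ModularForm.discriminant_eq_E₄_cube_sub_E₆_sq]
  ring

lemma algebraMap_mem_coeffSubfield {K : IntermediateField ℚ ℂ} {c : ℂ} (hc : c ∈ K) :
    HahnSeries.C c ∈ coeffSubfield K := by
  rw [mem_coeffSubfield]
  intro n
  by_cases hn : n = 0
  · simpa [HahnSeries.C_apply, hn] using hc
  · simp [HahnSeries.C_apply, hn]

/-- The expansion `j = q⁻¹ + ⋯` has rational coefficients, since `j = E₄³ / Δ` with
`1728 Δ = E₄³ - E₆²`. -/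
lemma exists_hasQExp_jMero :
    ∃ P : LaurentSeries ℂ, HasQExp jMero P ∧ P ∈ coeffSubfield ⊥ ∧ P.coeff (-1) = 1 := by
  obtain ⟨D, hD⟩ : ∃ D, D = qExpansion 1 CuspForm.discriminant := ⟨_, rfl⟩
  obtain ⟨E, hE⟩ : ∃ E, E = qExpansion 1 E₄ := ⟨_, rfl⟩
  obtain ⟨E', hE'⟩ : ∃ E, E = qExpansion 1 E₆ := ⟨_, rfl⟩
  have hD1 : D.coeff 1 = 1 := hD ▸ ModularForm.discriminant_qExpansion_coeff_one
  have hDo : D.order = 1 := hD ▸ ModularForm.discriminant_qExpansion_order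
  have hD0 : D.coeff 0 = 0 := PowerSeries.coeff_of_lt_order 0 (by rw [hDo]; simp)
  have hE0 : PowerSeries.constantCoeff E = 1 := by
    rw [← PowerSeries.coeff_zero_eq_constantCoeff_apply, hE]
    exact EisensteinSeries.E_qExpansion_coeff_zero _ ⟨2, rfl⟩
  have h1 := hasQExp_of_modularForm CuspForm.discriminant
  have h2 := hasQExp_of_modularForm E₄
  have h3 := hasQExp_of_modularForm E₆
  have hE_mem := eisenstein_mem_coeffSubfield (k := 4) (by norm_num) ⟨2, rfl⟩
  have hE_mem' := eisenstein_mem_coeffSubfield (k := 6) (by norm_num) ⟨3, rfl⟩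
  rw [← hD] at h1
  rw [← hE] at h2 hE_mem
  rw [← hE'] at h3 hE_mem'
  clear hD hE hE'
  obtain ⟨P, hP⟩ : ∃ P, HasQExp jMero P := ⟨_, coe_jX 1 ▸ hasQExp_qExp (jX 1)⟩
  have r1 := (hP.mul h1)
  rw [jMero_mul_discriminant] at r1
  replace r1 := r1.unique ((h2.mul h2).mul h2)
  have r2 := (hasQExp_algebraMap 1728).mul h1
  rw [discriminant_mul] at r2
  replace r2 := r2.unique (((h2.mul h2).mul h2).add ((hasQExp_algebraMap (-1)).mul (h3.mul h3)))
  have hDne : HahnSeries.ofPowerSeries ℤ ℂ D ≠ 0 := by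
    rw [Ne, ← map_zero (HahnSeries.ofPowerSeries ℤ ℂ), HahnSeries.ofPowerSeries_injective.eq_iff]
    rintro rfl
    simp at hD1
  have hDmem : HahnSeries.ofPowerSeries ℤ ℂ D ∈ coeffSubfield ⊥ := by
    have hc : (HahnSeries.C (1728 : ℂ) : LaurentSeries ℂ) ≠ 0 :=
      (map_ne_zero_iff _ HahnSeries.C_injective).2 (by norm_num)
    rw [← mul_div_cancel_left₀ (HahnSeries.ofPowerSeries ℤ ℂ D) hc, r2]
    exact div_mem (add_mem (mul_mem (mul_mem hE_mem hE_mem) hE_mem)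
      (mul_mem (algebraMap_mem_coeffSubfield (neg_mem (one_mem _))) (mul_mem hE_mem' hE_mem')))
      (algebraMap_mem_coeffSubfield (ofNat_mem _ 1728))
  have hPmem : P ∈ coeffSubfield ⊥ := by
    rw [← mul_div_cancel_right₀ P hDne, r1]
    exact div_mem (mul_mem (mul_mem hE_mem hE_mem) hE_mem) hDmem
  refine ⟨P, hP, hPmem, ?_⟩
  -- write `Δ = q D'` with `D' = 1 + ⋯`, so that `j = q⁻¹ E₄³ / D'`
  obtain ⟨D', rfl⟩ : PowerSeries.X ∣ D := by
    rw [PowerSeries.X_dvd_iff, ← PowerSeries.coeff_zero_eq_constantCoeff_apply, hD0]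
  have hD' : PowerSeries.constantCoeff D' = 1 := by
    rw [← zero_add 1, PowerSeries.coeff_succ_X_mul] at hD1
    simpa using hD1
  have hP' : P = HahnSeries.single (-1) 1 * HahnSeries.ofPowerSeries ℤ ℂ (E * E * E * D'⁻¹) := by
    apply mul_right_cancel₀ hDne
    rw [r1, ← map_mul, ← map_mul, map_mul _ PowerSeries.X, HahnSeries.ofPowerSeries_X,
      mul_mul_mul_comm, HahnSeries.single_mul_single, ← map_mul, mul_assoc _ D'⁻¹,
      PowerSeries.inv_mul_cancel _ (by rw [hD']; exact one_ne_zero)]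
    simp
  have h0 := HahnSeries.ofPowerSeries_apply_coeff (Γ := ℤ) (E * E * E * D'⁻¹) 0
  rw [hP', HahnSeries.coeff_single_mul, one_mul, sub_neg_eq_add, neg_add_cancel]
  refine h0.trans ?_
  rw [PowerSeries.coeff_zero_eq_constantCoeff_apply]
  simp [hE0, hD']

/-! ### Expansions of pull-backs -/

/-- The expansion of `φ(dz)` is obtained from that of `φ` by the substitution `q ↦ q^d`. -/
lemma HasQExp.scaling {φ : Mero} {P : LaurentSeries ℂ} (h : HasQExp φ P) (d : ℕ) [NeZero d]
    {K : IntermediateField ℚ ℂ} (hK : P ∈ coeffSubfield K) :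
    ∃ Q, HasQExp (pullback (scaling d) φ) Q ∧ Q ∈ coeffSubfield K := by
  obtain ⟨f, hf, hP⟩ := h
  have hd : (0 : ℤ) < d := by exact_mod_cast Nat.pos_of_ne_zero (NeZero.ne d)
  let e : ℤ ↪o ℤ := OrderEmbedding.ofStrictMono (fun n => d * n) fun a b hab =>
    mul_lt_mul_of_pos_left hab hd
  refine ⟨P.embDomain e, ⟨_, germ_pullback hf _, ?_⟩, mem_coeffSubfield.2 fun n => ?_⟩
  · filter_upwards [(tendsto_smul_of_upper (scaling_entries d).2.2.1).eventually hP] with z hz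
    refine (e.injective.hasSum_iff (fun m hm => ?_)).1 (hz.congr_fun fun n => ?_)
    · rw [HahnSeries.embDomain_of_notMem_range hm, zero_mul]
    · have hq : Function.Periodic.qParam 1 ((ModularCurve.scaling d • z : ℍ) : ℂ) =
          Function.Periodic.qParam 1 (z : ℂ) ^ (d : ℤ) := by
        rw [coe_scaling_smul, Function.Periodic.qParam, Function.Periodic.qParam,
          zpow_natCast, ← Complex.exp_nat_mul]
        congr 1
        ring
      rw [Function.comp_apply, HahnSeries.embDomain_coeff, hq, ← zpow_mul]
      rfl
  · by_cases hn : n ∈ Set.range e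
    · obtain ⟨m, rfl⟩ := hn
      rw [HahnSeries.embDomain_coeff]
      exact mem_coeffSubfield.1 hK m
    · rw [HahnSeries.embDomain_of_notMem_range hn]
      exact zero_mem K

/-- The translation `z ↦ z + x` multiplies the `n`-th Fourier coefficient by `exp(2πix)^n`. -/
lemma HasQExp.transl {φ : Mero} {P : LaurentSeries ℂ} (h : HasQExp φ P) (x : ℝ) :
    ∃ Q : LaurentSeries ℂ, HasQExp (pullback (transl x) φ) Q ∧
      ∀ n, Q.coeff n = Complex.exp (2 * Real.pi * Complex.I * x) ^ n * P.coeff n := by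
  obtain ⟨f, hf, hP⟩ := h
  refine ⟨⟨fun n => Complex.exp (2 * Real.pi * Complex.I * x) ^ n * P.coeff n,
    P.isPWO_support.mono fun n hn h0 => hn ?_⟩, ⟨_, germ_pullback hf _, ?_⟩, fun n => rfl⟩
  · simp [h0]
  · filter_upwards [(tendsto_smul_of_upper (transl_entries x).2.2.1).eventually hP] with z hz
    refine hz.congr_fun fun n => ?_
    have hq : Function.Periodic.qParam 1 ((ModularCurve.transl x • z : ℍ) : ℂ) =
        Complex.exp (2 * Real.pi * Complex.I * x) * Function.Periodic.qParam 1 (z : ℂ) := by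
      rw [transl_smul, Function.Periodic.qParam, Function.Periodic.qParam, ← Complex.exp_add,
        coe_vadd]
      congr 1
      push_cast
      ring
    rw [hq, mul_zpow]
    ring

lemma jX_mem_rationalFunctions (N : ℕ) : jX N ∈ rationalFunctions N := by
  obtain ⟨P, hP, hK, -⟩ := exists_hasQExp_jMero
  rw [mem_rationalFunctions_iff, qExp_eq (P := P) (by rwa [coe_jX])]
  exact hK

lemma jNX_mem_rationalFunctions (N : ℕ) [NeZero N] : jNX N ∈ rationalFunctions N := by
  obtain ⟨P, hP, hK, -⟩ := exists_hasQExp_jMero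
  obtain ⟨Q, hQ, hQK⟩ := hP.scaling N hK
  rw [mem_rationalFunctions_iff, qExp_eq (P := Q) hQ]
  exact hQK

/-! ### The function field over `K` in terms of expansions -/

/-- Applying a `K`-linear map to the coefficients commutes with multiplication by a series with
coefficients in `K`. -/
lemma coeff_mul_of_mem_coeffSubfield {K : IntermediateField ℚ ℂ} {P : LaurentSeries ℂ}
    (hP : P ∈ coeffSubfield K) (μ : ℂ →ₗ[K] K) {A B : LaurentSeries ℂ}
    (hAB : ∀ n, B.coeff n = μ (A.coeff n)) (n : ℤ) :
    (P * B).coeff n = μ ((P * A).coeff n) := by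
  have hs : B.support ⊆ A.support := fun n hn h0 => hn (by rw [hAB, h0]; simp)
  rw [HahnSeries.coeff_mul_right' A.isPWO_support hs, HahnSeries.coeff_mul, map_sum,
    AddSubmonoidClass.coe_finsetSum]
  refine Finset.sum_congr rfl fun ij _ => ?_
  obtain ⟨p, hp⟩ : ∃ p : K, (p : ℂ) = P.coeff ij.1 := ⟨⟨_, mem_coeffSubfield.1 hP _⟩, rfl⟩
  rw [hAB, ← hp]
  exact congrArg Subtype.val (μ.map_smul p (A.coeff ij.2)).symm

lemma qExp_mem_of_mem_functionFieldOver {N : ℕ} {K : IntermediateField ℚ ℂ}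
    {φ : complexFunctionField N} (h : φ ∈ functionFieldOver N K) : qExp N φ ∈ coeffSubfield K := by
  induction h using IntermediateField.adjoin_induction with
  | mem x hx => exact coeffSubfield_mono bot_le (mem_rationalFunctions_iff.1 hx)
  | algebraMap c =>
    have : algebraMap K (complexFunctionField N) c =
      algebraMap ℂ (complexFunctionField N) c := rfl
    rw [this, qExp_algebraMap]
    exact algebraMap_mem_coeffSubfield c.2
  | add x y _ _ hx hy => rw [map_add]; exact add_mem hx hy
  | inv x _ hx => rw [map_inv₀]; exact inv_mem hx
  | mul x y _ _ hx hy => rw [map_mul]; exact mul_mem hx hy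

lemma adjoin_le_functionFieldOver (N : ℕ) [NeZero N] (K : IntermediateField ℚ ℂ) :
    IntermediateField.adjoin K {jX N, jNX N} ≤ functionFieldOver N K := by
  refine IntermediateField.adjoin.mono _ _ _ ?_
  rintro _ (rfl | rfl)
  exacts [jX_mem_rationalFunctions N, jNX_mem_rationalFunctions N]

/-- A `K`-linear map `ℂ → K` can be applied to the coefficients of a polynomial in `j(z)` and
`j(Nz)`. -/
lemma exists_coeff_eq {N : ℕ} [NeZero N] {K : IntermediateField ℚ ℂ} {ψ : complexFunctionField N}
    (h : ψ ∈ Algebra.adjoin ℂ {jX N, jNX N}) (μ : ℂ →ₗ[K] K) :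
    ∃ ψ' ∈ IntermediateField.adjoin K {jX N, jNX N},
      ∀ n, (qExp N ψ').coeff n = μ ((qExp N ψ).coeff n) := by
  rw [← Subalgebra.mem_toSubmodule, Algebra.adjoin_eq_span] at h
  induction h using Submodule.span_induction generalizing μ with
  | mem x hx =>
    have hx' : x ∈ IntermediateField.adjoin K {jX N, jNX N} :=
      (Submonoid.closure_le (S := (IntermediateField.adjoin K
        {jX N, jNX N}).toSubfield.toSubmonoid)).2 (IntermediateField.subset_adjoin _ _) hx
    refine ⟨algebraMap K _ (μ 1) * x, mul_mem (IntermediateField.algebraMap_mem _ _) hx',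
      fun n => ?_⟩
    have : algebraMap K (complexFunctionField N) (μ 1) =
      algebraMap ℂ (complexFunctionField N) (μ 1) := rfl
    rw [map_mul, this, qExp_algebraMap, HahnSeries.C_mul_eq_smul, HahnSeries.coeff_smul]
    obtain ⟨p, hp⟩ : ∃ p : K, (p : ℂ) = (qExp N x).coeff n :=
      ⟨⟨_, mem_coeffSubfield.1 (qExp_mem_of_mem_functionFieldOver
        (adjoin_le_functionFieldOver N K hx')) _⟩, rfl⟩
    have h1 := congrArg (Subtype.val) (μ.map_smul p 1)
    rw [← hp, show ((p : ℂ)) = p • (1 : ℂ) by rw [Algebra.smul_def, mul_one]; rfl, h1, smul_eq_mul,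
      Algebra.smul_def, mul_one]
    exact mul_comm _ _
  | zero => exact ⟨0, zero_mem _, fun n => by simp⟩
  | add x y _ _ hx hy =>
    obtain ⟨x', hx', h1⟩ := hx μ
    obtain ⟨y', hy', h2⟩ := hy μ
    exact ⟨x' + y', add_mem hx' hy', fun n => by simp [h1, h2]⟩
  | smul c x _ hx =>
    -- the factor `c` is moved into the linear map
    obtain ⟨x', hx', h1⟩ := hx (μ.comp (LinearMap.mulLeft K c))
    refine ⟨x', hx', fun n => ?_⟩
    rw [h1, Algebra.smul_def, map_mul, qExp_algebraMap, HahnSeries.C_mul_eq_smul,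
      HahnSeries.coeff_smul]
    rfl

/-- If `φ = P / Q` for polynomials `P`, `Q` in `j(z)` and `j(Nz)` over `ℂ`, and if `φ` has
coefficients in `K`, then a suitable linear map `ℂ → K`, applied to the coefficients in `φ Q = P`,
produces such polynomials over `K`. -/
lemma mem_adjoin_of_qExp_mem {N : ℕ} [NeZero N] {K : IntermediateField ℚ ℂ}
    {φ : complexFunctionField N} (hφ : qExp N φ ∈ coeffSubfield K) :
    φ ∈ IntermediateField.adjoin K {jX N, jNX N} := by
  rcases eq_or_ne φ 0 with rfl | hφ0
  · exact zero_mem _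
  obtain ⟨P, hP, Q, hQ, rfl⟩ := IntermediateField.mem_adjoin_iff_div.1 (mem_adjoin_jX_jNX φ)
  have hQ0 : Q ≠ 0 := by rintro rfl; simp at hφ0
  obtain ⟨n, hn⟩ : ∃ n, (qExp N Q).coeff n ≠ 0 := by
    by_contra! h
    exact hQ0 ((map_eq_zero (qExp N)).1 (HahnSeries.ext (funext h)))
  obtain ⟨μ, hμ⟩ : ∃ μ : ℂ →ₗ[K] K, μ ((qExp N Q).coeff n) ≠ 0 := by
    by_contra! h
    exact hn ((Module.forall_dual_apply_eq_zero_iff K _).1 h)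
  obtain ⟨P', hP', h1⟩ := exists_coeff_eq hP μ
  obtain ⟨Q', hQ', h2⟩ := exists_coeff_eq hQ μ
  have hQ'0 : Q' ≠ 0 := by
    rintro rfl
    have := h2 n
    simp at this
    exact hμ (Subtype.ext this.symm)
  have h3 : P / Q * Q' = P' := by
    refine (qExp N).injective (HahnSeries.ext (funext fun k => ?_))
    rw [map_mul, coeff_mul_of_mem_coeffSubfield hφ μ h2, h1, ← map_mul, div_mul_cancel₀ _ hQ0]
  rw [eq_div_of_mul_eq hQ'0 h3]
  exact div_mem hP' hQ'

/-- A function on `X₀(N)` belongs to `K(X₀(N))` if and only if its Fourier coefficients belong to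
`K`. -/
lemma mem_functionFieldOver_iff {N : ℕ} [NeZero N] {K : IntermediateField ℚ ℂ}
    {φ : complexFunctionField N} : φ ∈ functionFieldOver N K ↔ qExp N φ ∈ coeffSubfield K :=
  ⟨qExp_mem_of_mem_functionFieldOver, fun h =>
    adjoin_le_functionFieldOver N K (mem_adjoin_of_qExp_mem h)⟩

lemma functionFieldOver_eq_adjoin (N : ℕ) [NeZero N] (K : IntermediateField ℚ ℂ) :
    functionFieldOver N K = IntermediateField.adjoin K {jX N, jNX N} :=
  le_antisymm (fun _ h => mem_adjoin_of_qExp_mem (qExp_mem_of_mem_functionFieldOver h))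
    (adjoin_le_functionFieldOver N K)

/-! ### Fields of definition -/

lemma isDefinedOver_of_forall_mem {N : ℕ}
    {σ : complexFunctionField N ≃ₐ[ℂ] complexFunctionField N} {K : IntermediateField ℚ ℂ}
    (h : ∀ φ ∈ functionFieldOver N K, σ φ ∈ functionFieldOver N K)
    (h' : ∀ φ ∈ functionFieldOver N K, σ.symm φ ∈ functionFieldOver N K) : IsDefinedOver σ K :=
  ⟨{ toFun := fun φ => ⟨σ φ, h φ φ.2⟩
     invFun := fun φ => ⟨σ.symm φ, h' φ φ.2⟩
     left_inv := fun φ => Subtype.ext (σ.symm_apply_apply φ)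
     right_inv := fun φ => Subtype.ext (σ.apply_symm_apply φ)
     map_mul' := fun _ _ => Subtype.ext (map_mul σ _ _)
     map_add' := fun _ _ => Subtype.ext (map_add σ _ _)
     commutes' := fun c => Subtype.ext (σ.commutes (c : ℂ)) }, fun _ => rfl⟩

lemma IsDefinedOver.apply_mem {N : ℕ}
    {σ : complexFunctionField N ≃ₐ[ℂ] complexFunctionField N} {K : IntermediateField ℚ ℂ}
    (h : IsDefinedOver σ K) {φ : complexFunctionField N} (hφ : φ ∈ functionFieldOver N K) :
    σ φ ∈ functionFieldOver N K := by
  obtain ⟨τ, hτ⟩ := h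
  rw [← hτ ⟨φ, hφ⟩]
  exact (τ ⟨φ, hφ⟩).2

lemma map_mem_of_mem_adjoin {E : Type*} [Field E] [Algebra ℂ E] {K : IntermediateField ℚ ℂ}
    {S : Set E} {F : IntermediateField K E} (σ : E ≃ₐ[ℂ] E) (h : ∀ s ∈ S, σ s ∈ F) {x : E}
    (hx : x ∈ IntermediateField.adjoin K S) : σ x ∈ F := by
  induction hx using IntermediateField.adjoin_induction with
  | mem x hx => exact h x hx
  | algebraMap c =>
    have : σ (algebraMap K E c) = algebraMap K E c := σ.commutes (c : ℂ)
    rw [this]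
    exact F.algebraMap_mem _
  | add x y _ _ hx hy => rw [map_add]; exact add_mem hx hy
  | inv x _ hx => rw [map_inv₀]; exact inv_mem hx
  | mul x y _ _ hx hy => rw [map_mul]; exact mul_mem hx hy

lemma apply_mem_of_generators {N : ℕ} [NeZero N]
    (σ : complexFunctionField N ≃ₐ[ℂ] complexFunctionField N) {K : IntermediateField ℚ ℂ}
    (h : σ (jX N) ∈ functionFieldOver N K) (h' : σ (jNX N) ∈ functionFieldOver N K)
    (φ : complexFunctionField N) (hφ : φ ∈ functionFieldOver N K) :
    σ φ ∈ functionFieldOver N K := by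
  rw [functionFieldOver_eq_adjoin] at hφ
  refine map_mem_of_mem_adjoin σ (fun s hs => ?_) hφ
  rcases Set.mem_insert_iff.1 hs with e | e
  · rw [e]
    exact h
  · rw [Set.mem_singleton_iff.1 e]
    exact h'

lemma mem_functionFieldOver_of_hasQExp {N : ℕ} [NeZero N] {K : IntermediateField ℚ ℂ}
    {φ : complexFunctionField N} {ψ : Mero} (h : (φ : Mero) = ψ)
    (hψ : ∃ P, HasQExp ψ P ∧ P ∈ coeffSubfield K) : φ ∈ functionFieldOver N K := by
  obtain ⟨P, hP, hK⟩ := hψ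
  rw [mem_functionFieldOver_iff, qExp_eq (h ▸ hP)]
  exact hK

lemma exists_hasQExp_pullback_scaling_jMero (d : ℕ) [NeZero d] :
    ∃ P, HasQExp (pullback (scaling d) jMero) P ∧ P ∈ coeffSubfield ⊥ := by
  obtain ⟨P, hP, hK, -⟩ := exists_hasQExp_jMero
  exact hP.scaling d hK

lemma atkinLehner_det {M d : ℕ} {A B C D : ℤ} (hd : d ≠ 0)
    (hdet : (A * d) * (D * d) - B * ((d * M : ℕ) * C) = d) : A * (D * d) - B * (M * C) = 1 := by
  have h0 : (d : ℤ) ≠ 0 := by exact_mod_cast hd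
  apply mul_left_cancel₀ h0
  push_cast at hdet
  linear_combination hdet

lemma atkinLehnerMatrix_entries (N d : ℕ) (A B C D : ℤ) (hd : d ≠ 0)
    (hdet : (A * d) * (D * d) - B * (N * C) = d) :
    atkinLehnerMatrix N d A B C D hd hdet 0 0 = (√d)⁻¹ * (A * d) ∧
    atkinLehnerMatrix N d A B C D hd hdet 0 1 = (√d)⁻¹ * B ∧
    atkinLehnerMatrix N d A B C D hd hdet 1 0 = (√d)⁻¹ * (N * C) ∧
    atkinLehnerMatrix N d A B C D hd hdet 1 1 = (√d)⁻¹ * (D * d) := by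
  simp [atkinLehnerMatrix]

/-- Up to scalars, the matrix of `w_d` is the product of an element of `SL₂(ℤ)` and
`diag(d, 1)`. -/
lemma atkinLehnerMatrix_eq {M d : ℕ} [NeZero d] (A B C D : ℤ) (hd : d ≠ 0)
    (hdet : (A * d) * (D * d) - B * ((d * M : ℕ) * C) = d) : ∃ γ : SL(2, ℤ),
    atkinLehnerMatrix (d * M) d A B C D hd hdet = toReal γ * scaling d := by
  obtain ⟨γ, h1, h2, h3, h4⟩ := exists_toReal_entries (atkinLehner_det hd hdet)
  obtain ⟨s1, s2, s3, s4⟩ := scaling_entries d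
  obtain ⟨w1, w2, w3, w4⟩ := atkinLehnerMatrix_entries (d * M) d A B C D hd hdet
  have hs := sqrt_natCast_ne_zero d
  have hs2 : √(d : ℝ) ^ 2 = d := Real.sq_sqrt (Nat.cast_nonneg d)
  have hs3 : (√(d : ℝ))⁻¹ * d = √d := by
    field_simp
    exact hs2.symm
  refine ⟨γ, sl2_ext ?_ ?_ ?_ ?_⟩ <;>
    simp only [mul_entry, h1, h2, h3, h4, s1, s2, s3, s4, w1, w2, w3, w4] <;> push_cast
  · linear_combination (A : ℝ) * hs3
  · ring
  · linear_combination (M * C : ℝ) * hs3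
  · ring

/-- Up to scalars, `diag(N, 1)` times the matrix of `w_d` is the product of an element of `SL₂(ℤ)`
and `diag(N / d, 1)`. -/
lemma scaling_mul_atkinLehnerMatrix {M d : ℕ} [NeZero d] [NeZero M] [NeZero (d * M)]
    (A B C D : ℤ) (hd : d ≠ 0) (hdet : (A * d) * (D * d) - B * ((d * M : ℕ) * C) = d) :
    ∃ γ : SL(2, ℤ), scaling (d * M) * atkinLehnerMatrix (d * M) d A B C D hd hdet =
      toReal γ * scaling M := by
  obtain ⟨γ, h1, h2, h3, h4⟩ := exists_toReal_entries (a := A * d) (b := B * M) (c := C) (d := D)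
    (by linear_combination atkinLehner_det hd hdet)
  obtain ⟨s1, s2, s3, s4⟩ := scaling_entries M
  obtain ⟨t1, t2, t3, t4⟩ := scaling_entries (d * M)
  obtain ⟨w1, w2, w3, w4⟩ := atkinLehnerMatrix_entries (d * M) d A B C D hd hdet
  have hs := sqrt_natCast_ne_zero d
  have hr := sqrt_natCast_ne_zero M
  have hs2 : √(d : ℝ) ^ 2 = d := Real.sq_sqrt (Nat.cast_nonneg d)
  have hr2 : √(M : ℝ) ^ 2 = M := Real.sq_sqrt (Nat.cast_nonneg M)
  have ht : √((d * M : ℕ) : ℝ) = √d * √M := by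
    rw [Nat.cast_mul, Real.sqrt_mul (Nat.cast_nonneg d)]
  rw [ht] at t1 t4
  refine ⟨γ, sl2_ext ?_ ?_ ?_ ?_⟩ <;>
    simp only [mul_entry, h1, h2, h3, h4, s1, s2, s3, s4, t1, t2, t3, t4, w1, w2, w3, w4] <;>
    push_cast <;> generalize √(d : ℝ) = s at hs hs2 ⊢ <;> generalize √(M : ℝ) = r at hr hr2 ⊢ <;>
    rw [← hs2] <;> (try rw [← hr2]) <;> field_simp <;> ring

/-- The automorphism `w_d` maps `j(z)` to `j(dz)` and `j(Nz)` to `j((N/d)z)`, so it preserves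
`ℚ(X₀(N))`. -/
lemma atkinLehner_mem {N d : ℕ} [NeZero N] (hd : d ∣ N) (A B C D : ℤ)
    (hdet : (A * d) * (D * d) - B * (N * C) = d) (φ : complexFunctionField N)
    (hφ : φ ∈ functionFieldOver N ⊥) :
    atkinLehner hd A B C D hdet φ ∈ functionFieldOver N ⊥ := by
  have hd0 : d ≠ 0 := ne_zero_of_dvd_ne_zero (NeZero.ne N) hd
  obtain ⟨M, rfl⟩ := hd
  have : NeZero d := ⟨hd0⟩
  have : NeZero M := ⟨(mul_ne_zero_iff.1 (NeZero.ne (d * M))).2⟩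
  refine apply_mem_of_generators _ ?_ ?_ φ hφ
  · obtain ⟨γ, hγ⟩ := atkinLehnerMatrix_eq A B C D hd0 hdet
    refine mem_functionFieldOver_of_hasQExp (ψ := pullback (scaling d) jMero) ?_
      (exists_hasQExp_pullback_scaling_jMero d)
    change pullback (atkinLehnerMatrix (d * M) d A B C D hd0 hdet) (jX (d * M)) = _
    rw [coe_jX, hγ, ← pullback_pullback, pullback_jMero]
  · obtain ⟨γ, hγ⟩ := scaling_mul_atkinLehnerMatrix A B C D hd0 hdet
    refine mem_functionFieldOver_of_hasQExp (ψ := pullback (scaling M) jMero) ?_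
      (exists_hasQExp_pullback_scaling_jMero M)
    change pullback (atkinLehnerMatrix (d * M) d A B C D hd0 hdet) (jNX (d * M)) = _
    rw [coe_jNX, pullback_pullback, hγ, ← pullback_pullback, pullback_jMero]

lemma isDefinedOver_atkinLehner {N d : ℕ} [NeZero N] (hd : d ∣ N) (A B C D : ℤ)
    (hdet : (A * d) * (D * d) - B * (N * C) = d) :
    IsDefinedOver (atkinLehner hd A B C D hdet) ⊥ := by
  refine isDefinedOver_of_forall_mem (atkinLehner_mem hd A B C D hdet) fun φ hφ => ?_
  -- the inverse is again an Atkin–Lehner automorphism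
  have hdet' : (D * d) * (A * d) - (-B) * (N * (-C)) = d := by linear_combination hdet
  have h : (atkinLehner hd A B C D hdet).symm φ = atkinLehner hd D (-B) (-C) A hdet' φ := by
    refine Subtype.ext ?_
    have hd0 : d ≠ 0 := ne_zero_of_dvd_ne_zero (NeZero.ne N) hd
    change pullback (atkinLehnerMatrix N d A B C D hd0 hdet)⁻¹ φ =
      pullback (atkinLehnerMatrix N d D (-B) (-C) A hd0 hdet') φ
    rw [atkinLehnerMatrix_inv]
  rw [h]
  exact atkinLehner_mem hd D (-B) (-C) A hdet' φ hφ

lemma mem_functionFieldOver_of_transl {N : ℕ} [NeZero N] {K : IntermediateField ℚ ℂ} {x : ℝ}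
    (hx : Complex.exp (2 * Real.pi * Complex.I * x) ∈ K) {φ ψ : complexFunctionField N}
    (hφ : φ ∈ functionFieldOver N K) (h : (ψ : Mero) = pullback (transl x) φ) :
    ψ ∈ functionFieldOver N K := by
  obtain ⟨Q, hQ, hcoeff⟩ := (hasQExp_qExp φ).transl x
  refine mem_functionFieldOver_of_hasQExp h ⟨Q, hQ, mem_coeffSubfield.2 fun n => ?_⟩
  rw [hcoeff]
  exact mul_mem (zpow_mem hx n) (mem_coeffSubfield.1 (mem_functionFieldOver_iff.1 hφ) n)

/-- The automorphism `S_d` is defined over `K` if and only if `K` contains `exp(2πi/d)`; the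
condition is necessary because the coefficient of `j ∘ S_d` at `q⁻¹` is `exp(2πi/d)⁻¹`. -/
lemma isDefinedOver_translationAut_iff {N d : ℕ} [NeZero N] (hd : d ∣ nu2 N ∨ d ∣ nu3 N)
    (K : IntermediateField ℚ ℂ) :
    IsDefinedOver (translationAut hd) K ↔ Complex.exp (2 * Real.pi * Complex.I / d) ∈ K := by
  have e1 : Complex.exp (2 * Real.pi * Complex.I * (1 / d : ℝ)) =
      Complex.exp (2 * Real.pi * Complex.I / d) := by
    congr 1
    push_cast
    ring
  constructor
  · intro h
    obtain ⟨P, hP, -, hP1⟩ := exists_hasQExp_jMero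
    obtain ⟨Q, hQ, hcoeff⟩ := hP.transl (1 / d)
    have h1 := qExp_mem_of_mem_functionFieldOver
      (h.apply_mem (IntermediateField.subset_adjoin _ _ (jX_mem_rationalFunctions N)))
    have h2 : qExp N (translationAut hd (jX N)) = Q := by
      refine qExp_eq ?_
      change HasQExp (pullback (transl (1 / d)) (jX N)) Q
      rwa [coe_jX]
    have h3 := mem_coeffSubfield.1 h1 (-1)
    rw [h2, hcoeff, hP1, mul_one, e1, zpow_neg_one] at h3
    exact inv_inv (Complex.exp (2 * Real.pi * Complex.I / d)) ▸ inv_mem h3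
  · intro h
    refine isDefinedOver_of_forall_mem (fun φ hφ => ?_) fun φ hφ => ?_
    · exact mem_functionFieldOver_of_transl (x := 1 / d) (by rwa [e1]) hφ rfl
    · refine mem_functionFieldOver_of_transl (x := -(1 / d)) ?_ hφ ?_
      · rw [Complex.ofReal_neg, mul_neg, Complex.exp_neg, e1]
        exact inv_mem h
      · change pullback (transl (1 / d))⁻¹ φ = _
        rw [transl_inv]

end ModularCurve

end

theorem mainTheorem3 (N : ℕ) [NeZero N] :
    -- every Atkin-Lehner involution has field of definition ℚ
    (∀ (d : ℕ) (hd : d ∣ N), d.Coprime (N / d) →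
      ∀ (A B C D : ℤ) (hdet : (A * d) * (D * d) - B * (N * C) = d),
        ModularCurve.IsFieldOfDefinition (ModularCurve.atkinLehner hd A B C D hdet) ⊥) ∧
    -- S₂ has field of definition ℚ
    (∀ h2 : 2 ∣ ModularCurve.nu2 N ∨ 2 ∣ ModularCurve.nu3 N,
      ModularCurve.IsFieldOfDefinition (ModularCurve.translationAut h2) ⊥) ∧
    -- for d > 2 the field of definition of S_d is ℚ(ζ_d)
    (∀ (d : ℕ) (hd : d ∣ ModularCurve.nu2 N ∨ d ∣ ModularCurve.nu3 N), 2 < d →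
      ∀ ζ : ℂ, IsPrimitiveRoot ζ d →
        ModularCurve.IsFieldOfDefinition (ModularCurve.translationAut hd)
          (IntermediateField.adjoin ℚ {ζ})) := by
  refine ⟨fun d hd _ A B C D hdet => ?_, fun h2 => ?_, fun d hd hd2 ζ hζ => ?_⟩
  · exact ⟨ModularCurve.isDefinedOver_atkinLehner hd A B C D hdet, fun _ _ => bot_le⟩
  · refine ⟨(ModularCurve.isDefinedOver_translationAut_iff h2 ⊥).2 ?_, fun _ _ => bot_le⟩
    rw [show 2 * Real.pi * Complex.I / (2 : ℕ) = Real.pi * Complex.I by push_cast; ring,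
      Complex.exp_pi_mul_I]
    exact neg_mem (one_mem _)
  · have hd0 : d ≠ 0 := by omega
    have : NeZero d := ⟨hd0⟩
    -- `ζ` and `exp(2πi/d)` are powers of each other
    have hξ := Complex.isPrimitiveRoot_exp d hd0
    refine ⟨(ModularCurve.isDefinedOver_translationAut_iff hd _).2 ?_, fun L hL => ?_⟩
    · obtain ⟨i, -, hi⟩ := hζ.eq_pow_of_pow_eq_one hξ.pow_eq_one
      rw [← hi]
      exact pow_mem (IntermediateField.mem_adjoin_simple_self ℚ ζ) i
    · obtain ⟨i, -, hi⟩ := hξ.eq_pow_of_pow_eq_one hζ.pow_eq_one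
      rw [IntermediateField.adjoin_simple_le_iff, ← hi]
      exact pow_mem ((ModularCurve.isDefinedOver_translationAut_iff hd L).1 hL) i
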